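/- **Setting.** Let $\overline\Omega_B$ and $\overline\Omega_D$ be polygonal regions in $\mathbb R^2$ with interiors $\Omega_B$, $\Omega_D$, let $\Omega$ be the interior of $\overline\Omega_B\cup\overline\Omega_D$, let $\Gamma=\partial\Omega_B\cap\partial\Omega_D$ be the interface, $\Gamma_i=\partial\Omega_i\setminus\Gamma$ for $i=B,D$, and $n_i$ the outward unit normal to $\Omega_i$. Let $\mathcal T_{u,i}$ be a partition of $\Omega_i$ into triangles and quadrilaterals. Each primal element is divided into triangles by joining an interior point (its center) to its vertices; the resulting triangles form $\mathcal T_{h,i}$, and $\mathcal T_{h,B}\cup\mathcal T_{h,D}$ is a conforming triangulation of $\Omega$ (so that $\Gamma$ is a union of edges, the set of which is $\mathcal F_{h,\Gamma}$). Let $\mathcal F_{dl,B}$ be the set of the new (dual) edges in $\Omega_B$, $\mathcal F_{pr,B}^0$ the set of the primal edges interior to $\Omega_B$, and $\mathcal F_{pr,B}$ the union of $\mathcal F_{pr,B}^0$ with the edges on $\Gamma_B$. On an edge, $n$ is a unit normal (outward to $\Omega_i$ on $\partial\Omega_i$), $t$ a unit tangent, and $[v]=v|_{\tau_1}-v|_{\tau_2}$,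 where $n$ points from $\tau_1$ to $\tau_2$; $[v]=v$ on boundary edges. Let $k\ge1$ and $$\begin{aligned} H_h^B&=\{v: v|_\tau\in P^k(\tau)^2,\ [v\cdot n]_e=0\ \forall e\in\mathcal F_{dl,B}\},\\ W_h^B&=\{G: G|_\tau\in P^k(\tau)^{2\times2},\ [Gn]_e=0\ \forall e\in\mathcal F_{pr,B}^0,\ [(Gn)\cdot t]_e=0\ \forall e\in\mathcal F_{dl,B},\ Gn=0\text{ on }\partial\Omega_B\},\\ Q_h^B&=\{q: q|_\tau\in P^k(\tau),\ [q]_e=0\ \forall e\in\mathcal F_{pr,B}^0\},\qquad Q_h^0=\{q\in Q_h^B:\textstyle\int_{\Omega_B}q=0\},\\ H_h^D&=\{v\in H(\mathrm{div};\Omega_D): v|_\tau\in P^k(\tau)^2\},\qquad Q_h^D=\{q\in L^2(\Omega_D): q|_\tau\in P^{k-1}(\tau)\},\\ H_{h,g}^D&=\{v\in H_h^D: v\cdot n=\Pi_{h,\Gamma_D}g\text{ on }\Gamma_D\}, \end{aligned}$$ where $\Pi_{h,\Gamma_i}$ is, on each edge $e\subset\Gamma_i$, the $L^2(e)$-projection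 onto $P^k(e)$. Put $$\begin{aligned} B_h^*(u,G)&=\sum_{e\in\mathcal F_{dl,B}}([Gn],(u\cdot n)n)_e-(\mathrm{div}_hG,u)_{\Omega_B},\\ B_h(L,v)&=-\sum_{e\in\mathcal F_{pr,B}^0}(Ln,[v])_e-\sum_{e\in\mathcal F_{dl,B}}((Ln)\cdot t,[v\cdot t])_e+(L,\nabla_hv)_{\Omega_B},\\ b_h^*(p,v)&=\sum_{e\in\mathcal F_{pr,B}}([v\cdot n],p)_e+\sum_{e\in\mathcal F_{h,\Gamma}}(v\cdot n_B,p)_e-(p,\mathrm{div}_hv)_{\Omega_B},\\ b_h(u,q)&=-\sum_{e\in\mathcal F_{dl,B}}(u\cdot n,[q])_e+(u,\nabla_hq)_{\Omega_B},\\ A_h(v,p)&=(p,\nabla\cdot v)_{\Omega_D},\qquad I_h(p,v)=\sum_{e\in\mathcal F_{h,\Gamma}}(v\cdot n_D,p)_e . \end{aligned}$$ Let $\epsilon>0$, let $\alpha$ (on $\Omega_B$) and $K_D$ (on $\Omega_D$) be symmetric positive definite $2\times2$ tensors with $\alpha$ and $K_D^{-1}$ integrable, let $f_B\in L^2(\Omega_B)^2$,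 $f_D\in L^2(\Omega_D)^2$, $f\in Q_h^D$, $g_1\in L^2(\Gamma_B)$, $g_2\in L^2(\Gamma_D)$, with the compatibility condition $\int_{\Gamma_B}g_1\,ds+\int_{\Gamma_D}g_2\,ds=\int_{\Omega_D}f\,dx$. Let $(L_h,u_{B,h},p_{B,h})\in W_h^B\times H_h^B\times Q_h^0$ and $(u_{D,h},p_{D,h})\in H_{h,g_2}^D\times Q_h^D$ satisfy $$\begin{aligned} (\epsilon^{-1}L_h,G)_{\Omega_B}-B_h^*(u_{B,h},G)+(K_D^{-1}u_{D,h},v_D)_{\Omega_D}+I_h(p_{B,h},v_D)-A_h(v_D,p_{D,h})&=(f_D,v_D)_{\Omega_D},\\ B_h(L_h,v_B)+(\alpha u_{B,h},v_B)_{\Omega_B}+b_h^*(p_{B,h},v_B)+A_h(u_{D,h},q_D)&=(f_B,v_B)_{\Omega_B}+(f,q_D)_{\Omega_D},\\ -I_h(q_B,u_{D,h})-b_h(u_{B,h},q_B)&=-(g_1,q_B)_{\Gamma_B} \end{aligned}$$ for all $(G,v_B,q_B)\in W_h^B\times H_h^B\times Q_h^0$ and $(v_D,q_D)\in H_{h,0}^D\times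 Q_h^D$. Let $u_h$ be the field with $u_h|_{\Omega_i}=u_{i,h}$, $i=B,D$. **Lemma (strong mass conservation).** The interface condition holds exactly for the discrete solution: $u_{B,h}\cdot n_D=u_{D,h}\cdot n_D$ on $\Gamma$. Moreover $u_h\in H(\mathrm{div};\Omega)$, $\nabla\cdot u_{B,h}=0$ in $\Omega_B$, $\nabla\cdot u_{D,h}=f$ in $\Omega_D$, and $u_{B,h}\cdot n_B=\Pi_{h,\Gamma_B}g_1$ on $\Gamma_B$. Consequently, if $u$, with $u|_{\Omega_i}=u_i\in L^2(\Omega_i)^2$, is any velocity field with $\nabla\cdot u_B=0$ in $\Omega_B$, $\nabla\cdot u_D=f$ in $\Omega_D$ and $u_D\cdot n_B=u_B\cdot n_B$ on $\Gamma$ (in particular, if $u$ is the exact velocity of the Brinkman–Darcy problem), then $\nabla\cdot(u-u_h)=0$ in $\Omega$. Here divergences are weak divergences, and normal components of $u_B$, $u_D$ are normal traces of $H(\mathrm{div})$ fields. -/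

import Mathlib

open MeasureTheory
open scoped ContDiff

namespace BrinkmanDarcy

noncomputable section

/-- The Euclidean plane. -/
abbrev E2 := EuclideanSpace ℝ (Fin 2)

/-! ### Weak divergence and `H(div; O)` -/

/-- Smooth test functions with compact support in `O`. -/
def IsTest (O : Set E2) (φ : E2 → ℝ) : Prop :=
  ContDiff ℝ ∞ φ ∧ HasCompactSupport φ ∧ tsupport φ ⊆ O

/-- `∇ · v = g` in `O`, in the weak (distributional) sense:
`∫_O v · ∇φ = - ∫_O g φ` for every test function `φ`. -/
def HasWeakDiv (O : Set E2) (v : E2 → E2) (g : E2 → ℝ) : Prop :=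
  ∀ φ : E2 → ℝ, IsTest O φ →
    ∫ x in O, fderiv ℝ φ x (v x) = - ∫ x in O, g x * φ x

/-- `v ∈ H(div; O)`: `v ∈ L²(O)²` and `∇ · v ∈ L²(O)`. -/
def MemHDiv (O : Set E2) (v : E2 → E2) : Prop :=
  MemLp v 2 (volume.restrict O) ∧
    ∃ g : E2 → ℝ, MemLp g 2 (volume.restrict O) ∧ HasWeakDiv O v g

/-- The normal trace of a field `v ∈ H(div; O)` with `∇ · v = g`, where the normal is outward to
`O`, as a functional on smooth functions: `⟨v · n, φ⟩ = ∫_O (v · ∇φ + (∇ · v) φ)`. -/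
def normalTrace (O : Set E2) (v : E2 → E2) (g : E2 → ℝ) (φ : E2 → ℝ) : ℝ :=
  ∫ x in O, (fderiv ℝ φ x (v x) + g x * φ x)

/-! ### Edges -/

/-- The integral `∫_e g ds` over the segment `e = [a, b]`. -/
def edgeInt (a b : E2) (g : E2 → ℝ) : ℝ :=
  dist a b * ∫ t in (0 : ℝ)..1, g (AffineMap.lineMap a b t)

/-- `g ∈ L²(e)` for the segment `e = [a, b]`. -/
def MemL2Edge (a b : E2) (g : E2 → ℝ) : Prop :=
  MemLp (fun t : ℝ => g (AffineMap.lineMap a b t)) 2 (volume.restrict (Set.Icc 0 1))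

/-- The unit tangent of `[a, b]`, pointing from `a` to `b`. -/
def unitTangent (a b : E2) : E2 := ‖b - a‖⁻¹ • (b - a)

/-- The unit normal of `[a, b]` pointing to the right when one walks from `a` to `b`. -/
def rightNormal (a b : E2) : E2 := ‖b - a‖⁻¹ • !₂[(b - a) 1, -(b - a) 0]

/-- Twice the signed area of the triangle `c a b`; positive iff `c, a, b` is counterclockwise. -/
def orient (c a b : E2) : ℝ := (a - c) 0 * (b - c) 1 - (a - c) 1 * (b - c) 0

/-! ### Polynomials -/

/-- Polynomials in the two coordinates of the plane. -/
abbrev Poly := MvPolynomial (Fin 2) ℝ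

/-- The value of a polynomial at a point. -/
def ev (p : Poly) (x : E2) : ℝ := MvPolynomial.eval (fun i => x i) p

/-- The value of a vector of polynomials at a point. -/
def evV (v : Fin 2 → Poly) (x : E2) : E2 := WithLp.toLp 2 (fun i => ev (v i) x)

/-- The component `v · n` at `x`. -/
def dotAt (v : Fin 2 → Poly) (n : E2) (x : E2) : ℝ := ∑ i, ev (v i) x * n i

/-- The vector `G n` at `x`. -/
def mulAt (G : Fin 2 → Fin 2 → Poly) (n : E2) (x : E2) (i : Fin 2) : ℝ :=
  ∑ j, ev (G i j) x * n j

/-- The divergence of a polynomial vector field. -/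
def divP (v : Fin 2 → Poly) : Poly := ∑ i, MvPolynomial.pderiv i (v i)

/-- Membership in `P^k`. -/
def IsPk (k : ℕ) (p : Poly) : Prop := p.totalDegree ≤ k

/-- `r|_e ∈ P^k(e)` for `e = [a, b]`. -/
def IsPkEdge (k : ℕ) (a b : E2) (r : E2 → ℝ) : Prop :=
  ∃ p : Poly, IsPk k p ∧ ∀ x ∈ segment ℝ a b, r x = ev p x

/-- On the edge `e = [a, b]`, `r` is the `L²(e)`-projection of `ψ` onto `P^k(e)`:
`r|_e ∈ P^k(e)` and `(ψ - r, χ)_e = 0` for all `χ ∈ P^k(e)`. -/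
def IsEdgeProj (k : ℕ) (a b : E2) (ψ r : E2 → ℝ) : Prop :=
  IsPkEdge k a b r ∧
    ∀ χ : Poly, IsPk k χ → edgeInt a b (fun x => (ψ x - r x) * ev χ x) = 0

/-! ### Meshes -/

/-- An element of the initial (primal) partition: a triangle or a quadrilateral, with its vertices
listed counterclockwise, together with an interior point `center` (which is joined to all the
vertices).  Positivity of the orientations says exactly that the triangles
`center, vertex i, vertex (i+1)` are nondegenerate, tile the polygon, and are listed
counterclockwise. For a convex polygon every interior point is allowed. -/
structure PrimalCell where
  n : ℕ
  n_eq : n = 3 ∨ n = 4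
  vertex : Fin n → E2
  center : E2
  ccw : ∀ i, 0 < orient center (vertex i) (vertex (finRotate n i))

/-- The vertices of the `i`-th subtriangle of a primal element. -/
def PrimalCell.verts (E : PrimalCell) (i : Fin E.n) : Set E2 :=
  {E.center, E.vertex i, E.vertex (finRotate E.n i)}

/-- Two different triangles of a triangulation, given by their vertices: they do not overlap, and
they meet in a common face (empty, a common vertex, or a common edge). -/
def MeetProperly (V W : Set E2) : Prop :=
  Disjoint (interior (convexHull ℝ V)) (interior (convexHull ℝ W)) ∧
    convexHull ℝ V ∩ convexHull ℝ W = convexHull ℝ (V ∩ W)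

/-- The initial partition of one of the two subdomains into finitely many triangles and
quadrilaterals, such that the triangulation obtained from it by joining the centers to the
vertices is conforming. -/
structure SubMesh where
  N : ℕ
  cell : Fin N → PrimalCell
  conforming : ∀ σ τ : (Σ c : Fin N, Fin (cell c).n), σ ≠ τ →
    MeetProperly ((cell σ.1).verts σ.2) ((cell τ.1).verts τ.2)

namespace SubMesh

variable (T : SubMesh)

/-- The triangles `τ ∈ 𝒯_h`: the triangle `⟨c, i⟩` has the vertices `ν, a, b`, where `ν` is the
center of the primal element `c`, and `a`, `b` are its vertices number `i` and `i + 1`.  Its edge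
`[a, b]` is primal, its edges `[ν, a]` and `[ν, b]` are dual. -/
abbrev Tri := Σ c : Fin T.N, Fin (T.cell c).n

variable {T} in
/-- The vertex `ν`. -/
def ctr (τ : T.Tri) : E2 := (T.cell τ.1).center

variable {T} in
/-- The vertex `a`. -/
def va (τ : T.Tri) : E2 := (T.cell τ.1).vertex τ.2

variable {T} in
/-- The vertex `b`. -/
def vb (τ : T.Tri) : E2 := (T.cell τ.1).vertex (finRotate _ τ.2)

variable {T} in
/-- All vertices of `τ`. -/
def verts (τ : T.Tri) : Set E2 := (T.cell τ.1).verts τ.2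

variable {T} in
/-- The closed triangle. -/
def elt (τ : T.Tri) : Set E2 := convexHull ℝ (verts τ)

variable {T} in
/-- The primal edge of `τ`, as an unordered pair of endpoints. -/
def primalEdge (τ : T.Tri) : Sym2 E2 := s(va τ, vb τ)

variable {T} in
/-- The unit normal on the primal edge `[a, b]` of `τ`, outward to `τ`. -/
def nPr (τ : T.Tri) : E2 := rightNormal (va τ) (vb τ)

/- The dual edges are also indexed by `τ`: the edge number `τ` is `[ν, a]`. It is shared by
`τ₁ = τ` and `τ₂ = prev τ`. -/

variable {T} in
/-- The neighbour of `τ` across the dual edge `[ν, a]`. -/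
def prev (τ : T.Tri) : T.Tri := ⟨τ.1, (finRotate _).symm τ.2⟩

variable {T} in
/-- The unit normal on the dual edge `[ν, a]`, pointing from `τ` to `prev τ`. -/
def nDl (τ : T.Tri) : E2 := rightNormal (ctr τ) (va τ)

variable {T} in
/-- The unit tangent on the dual edge `[ν, a]`. -/
def tDl (τ : T.Tri) : E2 := unitTangent (ctr τ) (va τ)

open Classical in
/-- The primal edges in the interior of the subdomain, each one given by the pair `(τ₁, τ₂)` of
the triangles that share it. The primal elements are numbered, and the normal of the edge points
from `τ₁`, in the element with the smaller number, to `τ₂`. -/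
def intEdges : Finset (T.Tri × T.Tri) :=
  Finset.univ.filter fun e => e.1.1 < e.2.1 ∧ primalEdge e.1 = primalEdge e.2

/-- The (open) subdomain. -/
def dom : Set E2 := interior (⋃ τ : T.Tri, elt τ)

/-- Families of polynomials, one for each triangle: scalar, vector and tensor fields. -/
abbrev Scal := T.Tri → Poly
abbrev Vect := T.Tri → Fin 2 → Poly
abbrev Tens := T.Tri → Fin 2 → Fin 2 → Poly

variable {T}

/-- A broken polynomial, as a function on the plane (defined outside the edges; zero on the
edges and outside the subdomain). -/
def funS (q : T.Scal) (x : E2) : ℝ :=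
  ∑ τ : T.Tri, (interior (elt τ)).indicator (ev (q τ)) x

/-- A broken polynomial vector field, as a function on the plane. -/
def funV (v : T.Vect) (x : E2) : E2 :=
  ∑ τ : T.Tri, (interior (elt τ)).indicator (evV (v τ)) x

variable (T)

/-- `∑_τ ∫_τ F_τ dx`. -/
def vol (F : T.Tri → E2 → ℝ) : ℝ := ∑ τ : T.Tri, ∫ x in elt τ, F τ x

/-- `∑_e ∫_e F_e ds` over the dual edges. -/
def sumDual (F : T.Tri → E2 → ℝ) : ℝ := ∑ τ : T.Tri, edgeInt (ctr τ) (va τ) (F τ)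

/-- `∑_e ∫_e F_e ds` over the interior primal edges. -/
def sumInt (F : T.Tri × T.Tri → E2 → ℝ) : ℝ :=
  ∑ e ∈ T.intEdges, edgeInt (va e.1) (vb e.1) (F e)

end SubMesh

open SubMesh

/-- The meshes of the Brinkman region (`B`) and of the Darcy region (`D`). They form together a
conforming triangulation of the whole domain (and so the interface is a union of edges). -/
structure Mesh where
  B : SubMesh
  D : SubMesh
  conforming : ∀ (σ : B.Tri) (τ : D.Tri), MeetProperly (verts σ) (verts τ)

namespace Mesh

variable (M : Mesh)

/-- The whole domain `Ω`. -/
def dom : Set E2 := interior ((⋃ τ : M.B.Tri, elt τ) ∪ ⋃ τ : M.D.Tri, elt τ)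

/-- The field `u` with `u|_{Ω_B} = vB` and `u|_{Ω_D} = vD`. -/
def glue (vB vD : E2 → E2) (x : E2) : E2 :=
  M.B.dom.indicator vB x + M.D.dom.indicator vD x

open Classical in
/-- The edges on the interface `Γ`, each one given by its Brinkman triangle and its Darcy
triangle. -/
def Γ : Finset (M.B.Tri × M.D.Tri) :=
  Finset.univ.filter fun e => primalEdge e.1 = primalEdge e.2

open Classical in
/-- The edges on `Γ_B = ∂Ω_B \ Γ`, given by their triangles. -/
def ΓB : Finset M.B.Tri :=
  Finset.univ.filter fun σ => (∀ τ : M.B.Tri, τ ≠ σ → primalEdge τ ≠ primalEdge σ) ∧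
    ∀ τ : M.D.Tri, primalEdge τ ≠ primalEdge σ

open Classical in
/-- The edges on `Γ_D = ∂Ω_D \ Γ`, given by their triangles. -/
def ΓD : Finset M.D.Tri :=
  Finset.univ.filter fun σ => (∀ τ : M.D.Tri, τ ≠ σ → primalEdge τ ≠ primalEdge σ) ∧
    ∀ τ : M.B.Tri, primalEdge τ ≠ primalEdge σ

/-- The unit normal `n_B` on an edge of `Γ`, outward to `Ω_B`. -/
def nB (e : M.B.Tri × M.D.Tri) : E2 := nPr e.1

/-- The unit normal `n_D` on an edge of `Γ`, outward to `Ω_D`. -/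
def nD (e : M.B.Tri × M.D.Tri) : E2 := - nPr e.1

/-- `∑_e ∫_e F_e ds` over the edges on `Γ`. -/
def sumΓ (F : M.B.Tri × M.D.Tri → E2 → ℝ) : ℝ :=
  ∑ e ∈ M.Γ, edgeInt (va e.1) (vb e.1) (F e)

/-- `∑_e ∫_e F_e ds` over the edges on `Γ_B`. -/
def sumΓB (F : M.B.Tri → E2 → ℝ) : ℝ := ∑ σ ∈ M.ΓB, edgeInt (va σ) (vb σ) (F σ)

/-- `∑_e ∫_e F_e ds` over the edges on `Γ_D`. -/
def sumΓD (F : M.D.Tri → E2 → ℝ) : ℝ := ∑ σ ∈ M.ΓD, edgeInt (va σ) (vb σ) (F σ)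

/-! ### Finite element spaces -/

/-- `H_h^B`: normal components are continuous across the dual edges. -/
structure MemHB (k : ℕ) (v : M.B.Vect) : Prop where
  poly : ∀ τ i, IsPk k (v τ i)
  dual : ∀ τ : M.B.Tri, ∀ x ∈ segment ℝ (ctr τ) (va τ),
    dotAt (v τ) (nDl τ) x - dotAt (v (prev τ)) (nDl τ) x = 0

/-- `W_h^B`: `G n` is continuous across the interior primal edges, `(G n) · t` is continuous across
the dual edges, and `G n = 0` on `∂Ω_B = Γ_B ∪ Γ`. -/
structure MemWB (k : ℕ) (G : M.B.Tens) : Prop where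
  poly : ∀ τ i j, IsPk k (G τ i j)
  primal : ∀ e ∈ M.B.intEdges, ∀ x ∈ segment ℝ (va e.1) (vb e.1), ∀ i,
    mulAt (G e.1) (nPr e.1) x i - mulAt (G e.2) (nPr e.1) x i = 0
  dual : ∀ τ : M.B.Tri, ∀ x ∈ segment ℝ (ctr τ) (va τ),
    ∑ i, (mulAt (G τ) (nDl τ) x i - mulAt (G (prev τ)) (nDl τ) x i) * tDl τ i = 0
  bdryB : ∀ σ ∈ M.ΓB, ∀ x ∈ segment ℝ (va σ) (vb σ), ∀ i, mulAt (G σ) (nPr σ) x i = 0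
  bdryΓ : ∀ e ∈ M.Γ, ∀ x ∈ segment ℝ (va e.1) (vb e.1), ∀ i, mulAt (G e.1) (M.nB e) x i = 0

/-- `Q_h^B`: continuous across the interior primal edges. -/
structure MemQB (k : ℕ) (q : M.B.Scal) : Prop where
  poly : ∀ τ, IsPk k (q τ)
  primal : ∀ e ∈ M.B.intEdges, ∀ x ∈ segment ℝ (va e.1) (vb e.1),
    ev (q e.1) x - ev (q e.2) x = 0

/-- `Q_h^0`: the functions in `Q_h^B` with mean zero over `Ω_B`. -/
structure MemQ0 (k : ℕ) (q : M.B.Scal) : Prop extends M.MemQB k q where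
  mean : M.B.vol (fun τ => ev (q τ)) = 0

/-- `H_h^D`: piecewise polynomials in `H(div; Ω_D)`. -/
structure MemHD (k : ℕ) (v : M.D.Vect) : Prop where
  poly : ∀ τ i, IsPk k (v τ i)
  hdiv : MemHDiv M.D.dom (funV v)

/-- `H_{h,g}^D`: the fields in `H_h^D` with `v · n = Π_{h,Γ_D} g` on `Γ_D`. -/
structure MemHDg (k : ℕ) (g : E2 → ℝ) (v : M.D.Vect) : Prop extends M.MemHD k v where
  bdry : ∀ σ ∈ M.ΓD, IsEdgeProj k (va σ) (vb σ) g (dotAt (v σ) (nPr σ))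

/-- `Q_h^D`: piecewise polynomials of degree at most `k - 1` (where `k ≥ 1`). -/
def MemQD (k : ℕ) (q : M.D.Scal) : Prop := ∀ τ, IsPk (k - 1) (q τ)

/-! ### Forms

A jump on an edge is the trace from `τ₁` minus the trace from `τ₂`, where the normal of the edge
points from `τ₁` to `τ₂`; quantities that are single-valued on the edge are evaluated from
`τ₁`. -/

/-- `B_h^*(u, G)`. -/
def BhStar (u : M.B.Vect) (G : M.B.Tens) : ℝ :=
  M.B.sumDual (fun τ x => ∑ i, (mulAt (G τ) (nDl τ) x i - mulAt (G (prev τ)) (nDl τ) x i) *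
      (dotAt (u τ) (nDl τ) x * nDl τ i))
    - M.B.vol (fun τ x => ∑ i, ev (divP (G τ i)) x * ev (u τ i) x)

/-- `B_h(L, v)`. -/
def Bh (L : M.B.Tens) (v : M.B.Vect) : ℝ :=
  - M.B.sumInt (fun e x => ∑ i, mulAt (L e.1) (nPr e.1) x i * (ev (v e.1 i) x - ev (v e.2 i) x))
    - M.B.sumDual (fun τ x => (∑ i, mulAt (L τ) (nDl τ) x i * tDl τ i) *
        (dotAt (v τ) (tDl τ) x - dotAt (v (prev τ)) (tDl τ) x))
    + M.B.vol (fun τ x => ∑ i, ∑ j, ev (L τ i j) x * ev (MvPolynomial.pderiv j (v τ i)) x)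

/-- `b_h^*(p, v)`; the edges in `F_{pr,B}` are the interior primal edges and those on `Γ_B`. -/
def bhStar (p : M.B.Scal) (v : M.B.Vect) : ℝ :=
  M.B.sumInt (fun e x => (dotAt (v e.1) (nPr e.1) x - dotAt (v e.2) (nPr e.1) x) * ev (p e.1) x)
    + M.sumΓB (fun σ x => dotAt (v σ) (nPr σ) x * ev (p σ) x)
    + M.sumΓ (fun e x => dotAt (v e.1) (M.nB e) x * ev (p e.1) x)
    - M.B.vol (fun τ x => ev (p τ) x * ev (divP (v τ)) x)

/-- `b_h(u, q)`. -/
def bh (u : M.B.Vect) (q : M.B.Scal) : ℝ :=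
  - M.B.sumDual (fun τ x => dotAt (u τ) (nDl τ) x * (ev (q τ) x - ev (q (prev τ)) x))
    + M.B.vol (fun τ x => ∑ i, ev (u τ i) x * ev (MvPolynomial.pderiv i (q τ)) x)

/-- `A_h(v, p)`. -/
def Ah (v : M.D.Vect) (p : M.D.Scal) : ℝ :=
  M.D.vol (fun τ x => ev (p τ) x * ev (divP (v τ)) x)

/-- `I_h(p, v)`. -/
def Ih (p : M.B.Scal) (v : M.D.Vect) : ℝ :=
  M.sumΓ (fun e x => dotAt (v e.2) (M.nD e) x * ev (p e.1) x)

/-- `(L, uB, pB) ∈ W_h^B × H_h^B × Q_h^0` and `(uD, pD) ∈ H_{h,g₂}^D × Q_h^D` solve the discrete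
Brinkman-Darcy problem. -/
structure IsDiscreteSolution (k : ℕ) (ε : ℝ) (α K : E2 → Matrix (Fin 2) (Fin 2) ℝ)
    (fB fD : E2 → E2) (f g₁ g₂ : E2 → ℝ)
    (L : M.B.Tens) (uB : M.B.Vect) (pB : M.B.Scal) (uD : M.D.Vect) (pD : M.D.Scal) : Prop where
  memL : M.MemWB k L
  memuB : M.MemHB k uB
  mempB : M.MemQ0 k pB
  memuD : M.MemHDg k g₂ uD
  mempD : M.MemQD k pD
  eq1 : ∀ (G : M.B.Tens) (v : M.D.Vect), M.MemWB k G → M.MemHDg k 0 v →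
    M.B.vol (fun τ x => ∑ i, ∑ j, ε⁻¹ * ev (L τ i j) x * ev (G τ i j) x)
      - M.BhStar uB G
      + M.D.vol (fun τ x => ∑ i, ∑ j, (K x)⁻¹ i j * ev (uD τ j) x * ev (v τ i) x)
      + M.Ih pB v - M.Ah v pD
    = M.D.vol (fun τ x => ∑ i, fD x i * ev (v τ i) x)
  eq2 : ∀ (v : M.B.Vect) (q : M.D.Scal), M.MemHB k v → M.MemQD k q →
    M.Bh L v + M.B.vol (fun τ x => ∑ i, ∑ j, α x i j * ev (uB τ j) x * ev (v τ i) x)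
      + M.bhStar pB v + M.Ah uD q
    = M.B.vol (fun τ x => ∑ i, fB x i * ev (v τ i) x) + M.D.vol (fun τ x => f x * ev (q τ) x)
  eq3 : ∀ q : M.B.Scal, M.MemQ0 k q →
    - M.Ih q uD - M.bh uB q = - M.sumΓB (fun σ x => g₁ x * ev (q σ) x)

/-- The velocities `uB ∈ L²(Ω_B)²` and `uD ∈ L²(Ω_D)²` satisfy the mass balance equations
`∇ · uB = 0` in `Ω_B` and `∇ · uD = f` in `Ω_D`, and the interface condition
`uD · n_B = uB · n_B` on `Γ` in the sense of normal traces (test functions with compact support in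
`Ω` vanish on the remaining parts of the boundaries, and `n_D = - n_B` on `Γ`). -/
structure IsExactVelocity (f : E2 → ℝ) (uB uD : E2 → E2) : Prop where
  memB : MemLp uB 2 (volume.restrict M.B.dom)
  memD : MemLp uD 2 (volume.restrict M.D.dom)
  divB : HasWeakDiv M.B.dom uB 0
  divD : HasWeakDiv M.D.dom uD f
  interface : ∀ φ : E2 → ℝ, IsTest M.dom φ →
    - normalTrace M.D.dom uD f φ = normalTrace M.B.dom uB 0 φ

end Mesh

end

end BrinkmanDarcy

open BrinkmanDarcy BrinkmanDarcy.SubMesh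

namespace BrinkmanDarcy

noncomputable section

/-! ### Triangles -/

/-! Everything follows from choosing test functions in the second and third discrete equations; the
rest of the work is to pass between traces on edges and distributional statements.

Darcy side. With zero Brinkman test function the second equation says that div u_D and f have the
same moments against piecewise polynomials of degree k - 1. Both are such polynomials, hence equal
(`IsDiscreteSolution.divD_eq`). The divergence theorem on Ω_D, the boundary condition on Γ_D and the
compatibility condition then give ∫_Γ u_D · n_D = ∫_{Γ_B} g₁ (`IsDiscreteSolution.sumΓ_eq`). This is
exactly the third equation for constant q, so that equation holds without the mean value
restriction.

Brinkman side. Since u_B · n is continuous across dual edges, integrating b_h by parts leaves only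
primal edges (`MemHB.bh_eq`). The third equation becomes (`IsDiscreteSolution.mass_eq`) I_h(q, u_D)
+ ∑_τ ∫_{primal edge} (u_B · n) q - ∫ q div u_B = ∫_{Γ_B} g₁ q. Let λ be the barycentric coordinate
of the center of the primal element. It vanishes on the primal edge and is positive inside the
triangle, so q = λ div u_B is admissible, kills all edge terms, and forces div u_B = 0
(`IsDiscreteSolution.divB_eq_zero`). Because q may jump across dual edges, it can then be supported
on the one or two triangles at a single primal edge (`IsDiscreteSolution.mass_eq_of_finset`). This
separates the edges. The jump of u_B · n as test polynomial gives continuity on interior edges, the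
mismatch with u_D · n gives the interface condition, and arbitrary polynomials give the projection
property on Γ_B.

Back to distributions. On a conforming triangulation, a piecewise polynomial field has its piecewise
divergence as weak divergence iff its normal components match across shared edges
(`Triangulation.hasWeakDiv_iff`). This is applied to Ω_B, to Ω_D and to their union. The
combinatorics rests on oriented half-edges: conformity and the counterclockwise order make the
half-edge map injective, so each half-edge has at most one opposite. -/

/-- The closed triangle with the vertices `P 0`, `P 1`, `P 2`. -/
def triangle (P : Fin 3 → E2) : Set E2 := convexHull ℝ (Set.range P)

/-- The barycentric coordinate of `x` that belongs to the vertex `P i`, multiplied with twice the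
signed area of the triangle. -/
def bary (P : Fin 3 → E2) (i : Fin 3) (x : E2) : ℝ := orient x (P (i + 1)) (P (i + 2))

/-- Twice the signed area of a triangle. -/
def area2 (P : Fin 3 → E2) : ℝ := orient (P 0) (P 1) (P 2)

theorem continuous_orient_left (a b : E2) : Continuous fun x : E2 => orient x a b := by
  unfold orient; fun_prop

theorem continuous_bary (P : Fin 3 → E2) (i : Fin 3) : Continuous (bary P i) :=
  continuous_orient_left _ _

theorem orient_rotate (c a b : E2) : orient a b c = orient c a b := by
  simp only [orient, PiLp.sub_apply]; ring

theorem orient_swap (c a b : E2) : orient c b a = - orient c a b := by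
  simp only [orient]; ring

theorem bary_self (P : Fin 3 → E2) (i : Fin 3) : bary P i (P i) = area2 P := by
  fin_cases i
  · rfl
  · exact orient_rotate _ _ _
  · exact (orient_rotate _ _ _).trans (orient_rotate _ _ _)

theorem bary_add_one (P : Fin 3 → E2) (i : Fin 3) : bary P i (P (i + 1)) = 0 := by
  simp [bary, orient]

theorem bary_add_two (P : Fin 3 → E2) (i : Fin 3) : bary P i (P (i + 2)) = 0 := by
  simp only [bary, orient, PiLp.sub_apply]; ring

theorem sum_bary (P : Fin 3 → E2) (x : E2) : ∑ i, bary P i x = area2 P := by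
  simp only [Fin.sum_univ_three, bary, area2, orient, PiLp.sub_apply, Fin.isValue,
    Fin.reduceAdd, zero_add]
  ring

/-- Cramer's rule. Without normalisation both sides are polynomial in the coordinates, so no
division by the area is needed. -/
theorem sum_bary_smul (P : Fin 3 → E2) (x : E2) : ∑ i, bary P i x • P i = area2 P • x := by
  ext j
  fin_cases j <;>
  · simp only [Fin.sum_univ_three, bary, area2, orient, PiLp.sub_apply, Fin.isValue, Fin.reduceAdd,
      zero_add, PiLp.add_apply, PiLp.smul_apply, smul_eq_mul, Fin.mk_one, Fin.zero_eta]
    ring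

theorem bary_combo (P : Fin 3 → E2) (i : Fin 3) (x y : E2) {s t : ℝ} (h : s + t = 1) :
    bary P i (s • x + t • y) = s * bary P i x + t * bary P i y := by
  obtain rfl : s = 1 - t := by linarith
  simp only [bary, orient, PiLp.sub_apply, PiLp.add_apply, PiLp.smul_apply, smul_eq_mul]
  ring

theorem convex_bary_nonneg (P : Fin 3 → E2) (i : Fin 3) : Convex ℝ {x | 0 ≤ bary P i x} := by
  intro x hx y hy s t hs ht hst
  simp only [Set.mem_ofPred_eq] at *
  rw [bary_combo P i x y hst]
  positivity

theorem convex_bary_eq_zero (P : Fin 3 → E2) (i : Fin 3) : Convex ℝ {x | bary P i x = 0} := by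
  intro x hx y hy s t hs ht hst
  simp only [Set.mem_ofPred_eq] at *
  rw [bary_combo P i x y hst, hx, hy]
  simp

theorem fin_three_cases (i j : Fin 3) : j = i ∨ j = i + 1 ∨ j = i + 2 := by
  revert i j; decide

theorem bary_vertex_nonneg {P : Fin 3 → E2} (hP : 0 < area2 P) (i j : Fin 3) :
    0 ≤ bary P i (P j) := by
  rcases fin_three_cases i j with rfl | rfl | rfl
  · rw [bary_self]; exact hP.le
  · rw [bary_add_one]
  · rw [bary_add_two]

/-- Each half-plane is convex and contains the vertices. Conversely, the normalised coordinates are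
nonnegative weights of sum one that reproduce `x`. -/
theorem mem_triangle_iff {P : Fin 3 → E2} (hP : 0 < area2 P) {x : E2} :
    x ∈ triangle P ↔ ∀ i, 0 ≤ bary P i x := by
  constructor
  · intro hx i
    refine convexHull_min (t := {x | 0 ≤ bary P i x}) ?_ (convex_bary_nonneg P i) hx
    rintro _ ⟨j, rfl⟩
    exact bary_vertex_nonneg hP i j
  · intro h
    have hx : x = ∑ i, (bary P i x / area2 P) • P i := by
      have := sum_bary_smul P x
      rw [← inv_smul_eq_iff₀ hP.ne', Finset.smul_sum] at this
      simp only [smul_smul, ← div_eq_inv_mul] at this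
      exact this.symm
    rw [hx]
    refine (convex_convexHull ℝ _).sum_mem (fun i _ => div_nonneg (h i) hP.le) ?_
      fun i _ => subset_convexHull ℝ _ ⟨i, rfl⟩
    rw [← Finset.sum_div, sum_bary, div_self hP.ne']

theorem isClosed_triangle (P : Fin 3 → E2) : IsClosed (triangle P) :=
  ((Set.finite_range P).isCompact_convexHull (𝕜 := ℝ)).isClosed

theorem isCompact_triangle (P : Fin 3 → E2) : IsCompact (triangle P) :=
  (Set.finite_range P).isCompact_convexHull (𝕜 := ℝ)

theorem convex_triangle (P : Fin 3 → E2) : Convex ℝ (triangle P) := convex_convexHull ℝ _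

theorem mem_interior_triangle_iff {P : Fin 3 → E2} (hP : 0 < area2 P) {x : E2} :
    x ∈ interior (triangle P) ↔ ∀ i, 0 < bary P i x := by
  constructor
  · intro hx i
    have hx' := (mem_triangle_iff hP).1 (interior_subset hx) i
    refine hx'.lt_of_ne fun h0 => ?_
    -- Moving from `x` away from `P i` makes a vanishing coordinate negative at once, while the
    -- point stays in the triangle for small `t`.
    have hcont : Continuous fun t : ℝ => (1 + t) • x + (-t) • P i := by fun_prop
    have hmem : ∀ᶠ t in nhds (0 : ℝ), (1 + t) • x + (-t) • P i ∈ triangle P := by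
      refine hcont.continuousAt.eventually (mem_interior_iff_mem_nhds.1 ?_)
      simpa using hx
    obtain ⟨t, ht, ht0⟩ :=
      ((hmem.filter_mono nhdsWithin_le_nhds).and (self_mem_nhdsWithin (s := Set.Ioi (0 : ℝ)))).exists
    have := (mem_triangle_iff hP).1 ht i
    rw [bary_combo P i _ _ (by ring), ← h0, bary_self] at this
    have ht0' : 0 < t := ht0
    nlinarith
  · intro h
    refine mem_interior.2 ⟨{y | ∀ i, 0 < bary P i y}, fun y hy =>
      (mem_triangle_iff hP).2 fun i => (hy i).le, ?_, h⟩
    simp only [Set.ofPred_forall]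
    exact isOpen_iInter_of_finite fun i => isOpen_lt continuous_const (continuous_bary P i)

theorem vertex_injective {P : Fin 3 → E2} (hP : 0 < area2 P) : Function.Injective P := by
  intro i j hij
  by_contra hne
  have h1 := bary_self P i
  rw [hij] at h1
  rcases fin_three_cases i j with rfl | rfl | rfl
  · exact hne rfl
  · rw [bary_add_one] at h1; linarith
  · rw [bary_add_two] at h1; linarith

/-! ### Integrals over edges -/

theorem dist_mul_rightNormal (a b : E2) :
    dist a b • rightNormal a b = !₂[(b - a) 1, -(b - a) 0] := by
  rcases eq_or_ne a b with rfl | h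
  · ext i; fin_cases i <;> simp
  · rw [rightNormal, dist_comm, dist_eq_norm, smul_smul, mul_inv_cancel₀, one_smul]
    exact norm_ne_zero_iff.2 (sub_ne_zero.2 h.symm)

theorem rightNormal_swap (a b : E2) : rightNormal b a = - rightNormal a b := by
  rw [rightNormal, rightNormal, norm_sub_rev, ← smul_neg]
  congr 1
  ext i; fin_cases i <;> simp

theorem edgeInt_swap (a b : E2) (g : E2 → ℝ) : edgeInt b a g = edgeInt a b g := by
  have h := intervalIntegral.integral_comp_sub_left (a := 0) (b := 1)
    (fun t : ℝ => g (AffineMap.lineMap b a t)) 1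
  simp only [sub_zero, sub_self] at h
  rw [edgeInt, edgeInt, ← h, dist_comm]
  simp only [AffineMap.lineMap_apply_one_sub]

/-- The length factor of `edgeInt` cancels the normalisation of `rightNormal`; degenerate segments
are allowed. -/
theorem edgeInt_normal (a b : E2) (w : Fin 2 → E2 → ℝ) :
    edgeInt a b (fun x => ∑ i, w i x * rightNormal a b i) =
      ∫ t in (0 : ℝ)..1, (w 0 (AffineMap.lineMap a b t) * (b - a) 1 -
        w 1 (AffineMap.lineMap a b t) * (b - a) 0) := by
  rw [edgeInt, ← intervalIntegral.integral_const_mul]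
  congr 1
  ext t
  have h := dist_mul_rightNormal a b
  have h0 : dist a b * rightNormal a b 0 = (b - a) 1 := by
    rw [← smul_eq_mul, ← PiLp.smul_apply, h]; simp
  have h1 : dist a b * rightNormal a b 1 = -(b - a) 0 := by
    rw [← smul_eq_mul, ← PiLp.smul_apply, h]; simp
  rw [Fin.sum_univ_two]
  linear_combination w 0 (AffineMap.lineMap a b t) * h0 + w 1 (AffineMap.lineMap a b t) * h1

/-! ### The divergence theorem on a triangle -/

/-- The reference triangle. -/
def refTriangle : Set (ℝ × ℝ) := {z | 0 ≤ z.1 ∧ 0 ≤ z.2 ∧ z.1 + z.2 ≤ 1}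

theorem isCompact_refTriangle : IsCompact refTriangle := by
  refine (isCompact_Icc (a := ((0 : ℝ), (0 : ℝ))) (b := (1, 1))).of_isClosed_subset ?_ ?_
  · exact (isClosed_le continuous_const continuous_fst).inter
      ((isClosed_le continuous_const continuous_snd).inter
        (isClosed_le (continuous_fst.add continuous_snd) continuous_const))
  · rintro ⟨x, y⟩ ⟨h1, h2, h3⟩
    simp only at h1 h2 h3
    exact ⟨⟨h1, h2⟩, ⟨by simp only; linarith, by simp only; linarith⟩⟩

/-- Fubini: the slice at height `t` is the interval from `0` to `1 - t`, and the fundamental theorem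
of calculus applies on it. -/
theorem integral_refTriangle_fst {G G' : ℝ × ℝ → ℝ} (hG' : Continuous G')
    (hd : ∀ s t, HasDerivAt (fun s => G (s, t)) (G' (s, t)) s) :
    ∫ z in refTriangle, G' z = ∫ t in (0 : ℝ)..1, (G (1 - t, t) - G (0, t)) := by
  have hm := isCompact_refTriangle.isClosed.measurableSet
  have hint : Integrable (refTriangle.indicator G') (volume.prod volume) :=
    (integrable_indicator_iff hm).2 (hG'.continuousOn.integrableOn_compact isCompact_refTriangle)
  rw [← integral_indicator hm, Measure.volume_eq_prod, integral_prod_symm _ hint,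
    intervalIntegral.integral_of_le zero_le_one, ← integral_Icc_eq_integral_Ioc,
    ← integral_indicator measurableSet_Icc]
  congr 1
  ext t
  by_cases ht : t ∈ Set.Icc (0 : ℝ) 1
  · rw [Set.indicator_of_mem ht]
    have : (fun s => refTriangle.indicator G' (s, t)) =
        (Set.Icc 0 (1 - t)).indicator fun s => G' (s, t) := by
      ext s
      have : (s, t) ∈ refTriangle ↔ s ∈ Set.Icc 0 (1 - t) := by
        simp only [refTriangle, Set.mem_ofPred_eq, Set.mem_Icc]
        constructor
        · rintro ⟨h1, -, h3⟩; exact ⟨h1, by linarith⟩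
        · rintro ⟨h1, h3⟩; exact ⟨h1, ht.1, by linarith⟩
      simp only [Set.indicator, this]
    rw [this, integral_indicator measurableSet_Icc, integral_Icc_eq_integral_Ioc,
      ← intervalIntegral.integral_of_le (by linarith [ht.2])]
    exact intervalIntegral.integral_eq_sub_of_hasDerivAt (fun s _ => hd s t)
      ((hG'.comp (by fun_prop)).intervalIntegrable _ _)
  · rw [Set.indicator_of_notMem ht]
    refine integral_eq_zero_of_ae (Filter.Eventually.of_forall fun s => ?_)
    refine Set.indicator_of_notMem (fun h => ht ?_) _
    obtain ⟨h1, h2, h3⟩ := h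
    simp only at h1 h2 h3
    exact ⟨h2, by linarith⟩

theorem integral_refTriangle_swap (G : ℝ × ℝ → ℝ) :
    ∫ z in refTriangle, G z.swap = ∫ z in refTriangle, G z := by
  have h := (Measure.measurePreserving_swap (μ := (volume : Measure ℝ))
    (ν := (volume : Measure ℝ))).setIntegral_preimage_emb
      (MeasurableEquiv.prodComm (α := ℝ) (β := ℝ)).measurableEmbedding G refTriangle
  have hs : Prod.swap ⁻¹' refTriangle = refTriangle := by
    ext z
    simp only [refTriangle, Set.mem_preimage, Set.mem_ofPred_eq, Prod.fst_swap, Prod.snd_swap,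
      add_comm z.2 z.1]
    tauto
  rw [hs] at h
  exact h

theorem integral_refTriangle_snd {G G' : ℝ × ℝ → ℝ} (hG' : Continuous G')
    (hd : ∀ s t, HasDerivAt (fun t => G (s, t)) (G' (s, t)) t) :
    ∫ z in refTriangle, G' z = ∫ s in (0 : ℝ)..1, (G (s, 1 - s) - G (s, 0)) := by
  rw [← integral_refTriangle_swap]
  exact integral_refTriangle_fst (G := fun z => G z.swap) (G' := fun z => G' z.swap)
    (hG'.comp continuous_swap) fun s t => hd t s

/-- The affine parametrization of a triangle over the reference triangle. -/
def param (P : Fin 3 → E2) (z : ℝ × ℝ) : E2 :=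
  P 0 + (z.1 • (P 1 - P 0) + z.2 • (P 2 - P 0))

theorem bary_param (P : Fin 3 → E2) (z : ℝ × ℝ) :
    bary P 0 (param P z) = (1 - z.1 - z.2) * area2 P ∧ bary P 1 (param P z) = z.1 * area2 P ∧
      bary P 2 (param P z) = z.2 * area2 P := by
  refine ⟨?_, ?_, ?_⟩ <;>
  · simp only [bary, area2, orient, param, PiLp.sub_apply, PiLp.add_apply, PiLp.smul_apply,
      smul_eq_mul, Fin.isValue, Fin.reduceAdd, zero_add]
    ring

theorem image_param {P : Fin 3 → E2} (hP : 0 < area2 P) : param P '' refTriangle = triangle P := by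
  ext x
  rw [mem_triangle_iff hP]
  constructor
  · rintro ⟨z, ⟨h1, h2, h3⟩, rfl⟩ i
    obtain ⟨e0, e1, e2⟩ := bary_param P z
    fin_cases i
    · exact e0 ▸ mul_nonneg (by linarith) hP.le
    · exact e1 ▸ mul_nonneg h1 hP.le
    · exact e2 ▸ mul_nonneg h2 hP.le
  · intro h
    refine ⟨(bary P 1 x / area2 P, bary P 2 x / area2 P),
      ⟨div_nonneg (h 1) hP.le, div_nonneg (h 2) hP.le, ?_⟩, ?_⟩
    · have := sum_bary P x
      rw [Fin.sum_univ_three] at this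
      simp only
      rw [← add_div, div_le_one hP]
      linarith [h 0]
    · refine smul_right_injective E2 hP.ne' ?_
      have hm : ∀ r, area2 P * (r / area2 P) = r := fun r => by field_simp
      have e := sum_bary_smul P x
      simp only [param, smul_add, smul_smul, hm]
      rw [← e, ← sum_bary P x, Fin.sum_univ_three, Fin.sum_univ_three]
      module

theorem injective_param {P : Fin 3 → E2} (hP : 0 < area2 P) : Function.Injective (param P) := by
  intro z w h
  obtain ⟨-, e1, e2⟩ := bary_param P z
  obtain ⟨-, d1, d2⟩ := bary_param P w
  rw [h] at e1 e2
  exact Prod.ext (mul_right_cancel₀ hP.ne' (e1.symm.trans d1))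
    (mul_right_cancel₀ hP.ne' (e2.symm.trans d2))

/-- The coordinates of the plane. -/
def coordEquiv : E2 ≃ᵐ ℝ × ℝ :=
  (MeasurableEquiv.toLp 2 (Fin 2 → ℝ)).symm.trans MeasurableEquiv.finTwoArrow

theorem measurePreserving_coordEquiv : MeasurePreserving coordEquiv :=
  (volume_preserving_finTwoArrow ℝ).comp
    (EuclideanSpace.volume_preserving_symm_measurableEquiv_toLp (Fin 2))

/-- Change of variables along `param`, whose Jacobian is `area2 P`; the counterclockwise order
removes the absolute value. -/
theorem integral_triangle_eq {P : Fin 3 → E2} (hP : 0 < area2 P) (h : E2 → ℝ) :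
    ∫ x in triangle P, h x = ∫ z in refTriangle, area2 P * h (param P z) := by
  set A := P 1 - P 0 with hA
  set B := P 2 - P 0 with hB
  let M : Matrix (Fin 2) (Fin 2) ℝ := !![A 0, B 0; A 1, B 1]
  let T : E2 →L[ℝ] E2 := (Matrix.toLpLin 2 2 M).toContinuousLinearMap
  have hT : ∀ x : E2, T x = x 0 • A + x 1 • B := by
    intro x
    ext i
    fin_cases i <;>
      simp [T, M, Matrix.toLpLin_apply, dotProduct,
        Fin.sum_univ_two, mul_comm]
  have hdet : T.det = area2 P := by
    change LinearMap.det (Matrix.toLpLin 2 2 M) = _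
    rw [Matrix.toLpLin_eq_toLin, LinearMap.det_toLin]
    simp only [M, Matrix.det_fin_two_of, area2, orient, hA, hB]
    ring
  have hc : ∀ x : E2, coordEquiv x = (x 0, x 1) := fun x => rfl
  have himg : (fun x => P 0 + T x) '' (coordEquiv ⁻¹' refTriangle) = triangle P := by
    rw [← image_param hP]
    ext y
    constructor
    · rintro ⟨x, hx, rfl⟩
      exact ⟨coordEquiv x, hx, by simp only [hT, param, hc]; rfl⟩
    · rintro ⟨z, hz, rfl⟩
      obtain ⟨x, rfl⟩ := coordEquiv.surjective z
      exact ⟨x, hz, by simp only [hT, param, hc]; rfl⟩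
  have hinj : Set.InjOn (fun x => P 0 + T x) (coordEquiv ⁻¹' refTriangle) := by
    intro x _ y _ hxy
    refine coordEquiv.injective (injective_param hP ?_)
    simpa only [hT, param, hc] using hxy
  rw [← himg, integral_image_eq_integral_abs_det_fderiv_smul volume
    (coordEquiv.measurable isCompact_refTriangle.isClosed.measurableSet)
    (fun x _ => (T.hasFDerivAt.const_add (P 0)).hasFDerivWithinAt) hinj,
    ← measurePreserving_coordEquiv.setIntegral_preimage_emb coordEquiv.measurableEmbedding]
  simp only [hdet, abs_of_pos hP, smul_eq_mul, hT, param, hc, hA, hB]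

theorem clm_apply_eq (D : E2 →L[ℝ] ℝ) (x : E2) :
    D x = ∑ i, x i * D (EuclideanSpace.single i 1) := by
  have : x = ∑ i, x i • EuclideanSpace.single i (1 : ℝ) := by
    ext j
    fin_cases j <;> simp [Fin.sum_univ_two]
  conv_lhs => rw [this]
  simp

/-- The divergence theorem on a triangle. -/
theorem integral_triangle_div {P : Fin 3 → E2} (hP : 0 < area2 P) {w : Fin 2 → E2 → ℝ}
    (hw : ∀ i, ContDiff ℝ 1 (w i)) :
    ∫ x in triangle P, ∑ i, fderiv ℝ (w i) x (EuclideanSpace.single i 1) =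
      ∑ j : Fin 3, edgeInt (P (j + 1)) (P (j + 2))
        (fun x => ∑ i, w i x * rightNormal (P (j + 1)) (P (j + 2)) i) := by
  rw [integral_triangle_eq hP]
  set A := P 1 - P 0 with hA
  set B := P 2 - P 0 with hB
  have hcp : Continuous (param P) := by unfold param; fun_prop
  have hcd : ∀ (i : Fin 2) (y : E2), Continuous fun z => fderiv ℝ (w i) (param P z) y := fun i y =>
    (((hw i).continuous_fderiv one_ne_zero).comp hcp).clm_apply continuous_const
  have hdiff : ∀ i x, HasFDerivAt (w i) (fderiv ℝ (w i) x) x := fun i x =>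
    ((hw i).differentiable one_ne_zero x).hasFDerivAt
  have hd1 : ∀ i s t, HasDerivAt (fun s => w i (param P (s, t)))
      (fderiv ℝ (w i) (param P (s, t)) A) s := by
    intro i s t
    have h : HasDerivAt (fun s => param P (s, t)) A s := by
      simpa [param] using ((((hasDerivAt_id s).smul_const A).add_const (t • B)).const_add (P 0))
    exact (hdiff i _).comp_hasDerivAt s h
  have hd2 : ∀ i s t, HasDerivAt (fun t => w i (param P (s, t)))
      (fderiv ℝ (w i) (param P (s, t)) B) t := by
    intro i s t
    have h : HasDerivAt (fun t => param P (s, t)) B t := by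
      simpa [param] using ((((hasDerivAt_id t).smul_const B).const_add (s • A)).const_add (P 0))
    exact (hdiff i _).comp_hasDerivAt t h
  -- `(G, H)` is the Piola transform of `w`: its divergence on the reference triangle is `area2 P`
  -- times the divergence of `w` (see `key`), and it carries normal fluxes to normal fluxes.
  let G : ℝ × ℝ → ℝ := fun z => w 0 (param P z) * B 1 - w 1 (param P z) * B 0
  let G' : ℝ × ℝ → ℝ := fun z => fderiv ℝ (w 0) (param P z) A * B 1 -
    fderiv ℝ (w 1) (param P z) A * B 0
  let H : ℝ × ℝ → ℝ := fun z => w 1 (param P z) * A 0 - w 0 (param P z) * A 1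
  let H' : ℝ × ℝ → ℝ := fun z => fderiv ℝ (w 1) (param P z) B * A 0 -
    fderiv ℝ (w 0) (param P z) B * A 1
  have hG' : Continuous G' :=
    ((hcd 0 A).mul continuous_const).sub ((hcd 1 A).mul continuous_const)
  have hH' : Continuous H' :=
    ((hcd 1 B).mul continuous_const).sub ((hcd 0 B).mul continuous_const)
  have key : ∀ z, area2 P * ∑ i, fderiv ℝ (w i) (param P z) (EuclideanSpace.single i 1) =
      G' z + H' z := by
    intro z
    simp only [G', H', clm_apply_eq _ A, clm_apply_eq _ B, Fin.sum_univ_two]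
    simp only [area2, orient, ← hA, ← hB]
    ring
  simp only [key]
  rw [integral_add (hG'.continuousOn.integrableOn_compact isCompact_refTriangle)
      (hH'.continuousOn.integrableOn_compact isCompact_refTriangle),
    integral_refTriangle_fst (G := G) hG'
      fun s t => ((hd1 0 s t).mul_const _).sub ((hd1 1 s t).mul_const _),
    integral_refTriangle_snd (G := H) hH'
      fun s t => ((hd2 1 s t).mul_const _).sub ((hd2 0 s t).mul_const _)]
  have hGc : Continuous G := by
    have := fun i => (hw i).continuous.comp hcp
    exact ((this 0).mul continuous_const).sub ((this 1).mul continuous_const)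
  have hHc : Continuous H := by
    have := fun i => (hw i).continuous.comp hcp
    exact ((this 1).mul continuous_const).sub ((this 0).mul continuous_const)
  have hflip : ∫ s in (0 : ℝ)..1, H (s, 1 - s) = ∫ t in (0 : ℝ)..1, H (1 - t, t) := by
    have h := intervalIntegral.integral_comp_sub_left (a := 0) (b := 1)
      (fun t : ℝ => H (t, 1 - t)) 1
    simp only [sub_zero, sub_self, sub_sub_cancel] at h
    exact h.symm
  have ii : ∀ {g : ℝ → ℝ}, Continuous g → IntervalIntegrable g volume 0 1 :=
    fun hg => hg.intervalIntegrable _ _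
  have c1 : Continuous fun t : ℝ => G (1 - t, t) := hGc.comp (by fun_prop)
  have c2 : Continuous fun t : ℝ => G (0, t) := hGc.comp (by fun_prop)
  have c3 : Continuous fun t : ℝ => H (1 - t, t) := hHc.comp (by fun_prop)
  have c4 : Continuous fun t : ℝ => H (t, 0) := hHc.comp (by fun_prop)
  have c5 : Continuous fun t : ℝ => H (t, 1 - t) := hHc.comp (by fun_prop)
  rw [intervalIntegral.integral_sub (ii c1) (ii c2), intervalIntegral.integral_sub (ii c5) (ii c4),
    hflip, Fin.sum_univ_three]
  simp only [Fin.isValue, zero_add, Fin.reduceAdd]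
  rw [edgeInt_normal (P 1) (P 2), edgeInt_normal (P 2) (P 0), edgeInt_normal (P 0) (P 1)]
  -- The hypotenuse of the reference triangle carries both `G` and `H`; each leg carries only one of
  -- them.
  have e0 : ∫ t in (0 : ℝ)..1, (w 0 (AffineMap.lineMap (P 1) (P 2) t) * (P 2 - P 1) 1 -
      w 1 (AffineMap.lineMap (P 1) (P 2) t) * (P 2 - P 1) 0) =
      (∫ t in (0 : ℝ)..1, G (1 - t, t)) + ∫ t in (0 : ℝ)..1, H (1 - t, t) := by
    rw [← intervalIntegral.integral_add (ii c1) (ii c3)]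
    congr 1; ext t
    have : AffineMap.lineMap (P 1) (P 2) t = param P (1 - t, t) := by
      simp only [AffineMap.lineMap_apply, vsub_eq_sub, vadd_eq_add, param]; module
    simp only [this, G, H, hA, hB, PiLp.sub_apply]
    ring
  have e1 : ∫ t in (0 : ℝ)..1, (w 0 (AffineMap.lineMap (P 2) (P 0) t) * (P 0 - P 2) 1 -
      w 1 (AffineMap.lineMap (P 2) (P 0) t) * (P 0 - P 2) 0) =
      - ∫ t in (0 : ℝ)..1, G (0, t) := by
    have h := intervalIntegral.integral_comp_sub_left (a := 0) (b := 1)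
      (fun t : ℝ => G (0, t)) 1
    simp only [sub_zero, sub_self] at h
    rw [← h, ← intervalIntegral.integral_neg]
    congr 1; ext t
    have : AffineMap.lineMap (P 2) (P 0) t = param P (0, 1 - t) := by
      simp only [AffineMap.lineMap_apply, vsub_eq_sub, vadd_eq_add, param]; module
    simp only [this, G, hB, PiLp.sub_apply]
    ring
  have e2 : ∫ t in (0 : ℝ)..1, (w 0 (AffineMap.lineMap (P 0) (P 1) t) * (P 1 - P 0) 1 -
      w 1 (AffineMap.lineMap (P 0) (P 1) t) * (P 1 - P 0) 0) =
      - ∫ t in (0 : ℝ)..1, H (t, 0) := by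
    rw [← intervalIntegral.integral_neg]
    congr 1; ext t
    have : AffineMap.lineMap (P 0) (P 1) t = param P (t, 0) := by
      simp only [AffineMap.lineMap_apply, vsub_eq_sub, vadd_eq_add, param]; module
    simp only [this, H, hA, PiLp.sub_apply]
    ring
  rw [e0, e1, e2]
  ring

/-! ### Polynomials as functions -/

theorem ev_add (p q : Poly) (x : E2) : ev (p + q) x = ev p x + ev q x := by simp [ev]

theorem ev_sub (p q : Poly) (x : E2) : ev (p - q) x = ev p x - ev q x := by simp [ev]

theorem ev_mul (p q : Poly) (x : E2) : ev (p * q) x = ev p x * ev q x := by simp [ev]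

theorem ev_C (r : ℝ) (x : E2) : ev (MvPolynomial.C r) x = r := by simp [ev]

theorem ev_zero (x : E2) : ev 0 x = 0 := by simp [ev]

theorem ev_one (x : E2) : ev 1 x = 1 := by simp [ev]

theorem ev_X (i : Fin 2) (x : E2) : ev (MvPolynomial.X i) x = x i := by simp [ev]

theorem contDiff_ev (p : Poly) : ContDiff ℝ ∞ (ev p) := by
  induction p using MvPolynomial.induction_on with
  | C r => simpa only [ev_C, funext (ev_C r)] using contDiff_const
  | add p q hp hq => simpa only [funext (ev_add p q)] using hp.add hq
  | mul_X p i hp =>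
    rw [funext (ev_mul p _), funext (ev_X i)]
    exact hp.mul (by fun_prop)

theorem continuous_ev (p : Poly) : Continuous (ev p) := (contDiff_ev p).continuous

theorem fderiv_ev (p : Poly) (x y : E2) :
    fderiv ℝ (ev p) x y = ∑ i, ev (MvPolynomial.pderiv i p) x * y i := by
  have hd : ∀ q, DifferentiableAt ℝ (ev q) x := fun q =>
    (contDiff_ev q).differentiable (by simp) x
  induction p using MvPolynomial.induction_on with
  | C r => simp [funext (ev_C r), ev_zero]
  | add p q hp hq =>
    rw [funext (ev_add p q), fderiv_fun_add (hd p) (hd q)]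
    simp only [add_apply, hp, hq, map_add, ev_add, add_mul,
      Finset.sum_add_distrib]
  | mul_X p i hp =>
    have hX : fderiv ℝ (ev (MvPolynomial.X i)) x y = y i := by
      rw [funext (ev_X i)]
      exact congrArg (· y) (EuclideanSpace.proj (𝕜 := ℝ) i : E2 →L[ℝ] ℝ).fderiv
    rw [funext (ev_mul p _), fderiv_fun_mul (hd p) (hd _)]
    simp only [add_apply, smul_apply, hp, hX, smul_eq_mul,
      Derivation.leibniz, ev_add, ev_mul, MvPolynomial.pderiv_X, ev_X, Finset.mul_sum]
    fin_cases i <;> simp [Fin.sum_univ_two, ev_zero, ev_one] <;> ring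

theorem contDiff_dotAt (v : Fin 2 → Poly) (n : E2) : ContDiff ℝ ∞ (dotAt v n) := by
  unfold dotAt
  exact ContDiff.sum fun i _ => (contDiff_ev (v i)).mul contDiff_const

theorem continuous_dotAt (v : Fin 2 → Poly) (n : E2) : Continuous (dotAt v n) :=
  (contDiff_dotAt v n).continuous

theorem continuous_evV (v : Fin 2 → Poly) : Continuous (evV v) := by
  have := fun i => continuous_ev (v i)
  unfold evV; fun_prop

theorem dotAt_neg (v : Fin 2 → Poly) (n x : E2) : dotAt v (-n) x = - dotAt v n x := by
  simp [dotAt]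

theorem continuous_fderiv_evV {φ : E2 → ℝ} (hφ : ContDiff ℝ 1 φ) (v : Fin 2 → Poly) :
    Continuous fun x => fderiv ℝ φ x (evV v x) :=
  (hφ.continuous_fderiv one_ne_zero).clm_apply (continuous_evV v)

/-- Green's formula on a triangle, for polynomial vector fields. -/
theorem integral_triangle_green {P : Fin 3 → E2} (hP : 0 < area2 P) (v : Fin 2 → Poly)
    {φ : E2 → ℝ} (hφ : ContDiff ℝ 1 φ) :
    ∫ x in triangle P, (fderiv ℝ φ x (evV v x) + ev (divP v) x * φ x) =
      ∑ j : Fin 3, edgeInt (P (j + 1)) (P (j + 2))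
        (fun x => dotAt v (rightNormal (P (j + 1)) (P (j + 2))) x * φ x) := by
  have h := integral_triangle_div hP (w := fun i x => ev (v i) x * φ x)
    fun i => ((contDiff_ev (v i)).of_le (by simp)).mul hφ
  simp only [dotAt, Finset.sum_mul]
  convert h using 2
  · ext x
    have hd : ∀ i, fderiv ℝ (fun x => ev (v i) x * φ x) x (EuclideanSpace.single i 1) =
        ev (v i) x * fderiv ℝ φ x (EuclideanSpace.single i 1) +
          φ x * ev (MvPolynomial.pderiv i (v i)) x := by
      intro i
      rw [fderiv_fun_mul ((contDiff_ev _).differentiable (by simp) x)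
        (hφ.differentiable one_ne_zero x)]
      simp [fderiv_ev]
    simp only [hd, clm_apply_eq _ (evV v x), Finset.sum_add_distrib, divP, ← Finset.mul_sum]
    simp only [Fin.sum_univ_two, ev_add, evV]
    ring
  · congr 1
    ext x
    exact Finset.sum_congr rfl fun i _ => by ring

/-! ### Integrals over edges of continuous functions -/

theorem continuous_lineMap (a b : E2) : Continuous fun t : ℝ => AffineMap.lineMap a b t := by
  simp only [AffineMap.lineMap_apply, vsub_eq_sub, vadd_eq_add]; fun_prop

theorem edgeInt_add (a b : E2) {g h : E2 → ℝ} (hg : Continuous g) (hh : Continuous h) :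
    edgeInt a b (fun x => g x + h x) = edgeInt a b g + edgeInt a b h := by
  rw [edgeInt, edgeInt, edgeInt, ← mul_add, intervalIntegral.integral_add]
  · exact (hg.comp (continuous_lineMap a b)).intervalIntegrable _ _
  · exact (hh.comp (continuous_lineMap a b)).intervalIntegrable _ _

theorem edgeInt_congr {a b : E2} {g h : E2 → ℝ}
    (hgh : ∀ s ∈ Set.Ioo (0 : ℝ) 1, g (AffineMap.lineMap a b s) = h (AffineMap.lineMap a b s)) :
    edgeInt a b g = edgeInt a b h := by
  rw [edgeInt, edgeInt]
  simp only [intervalIntegral.integral_of_le zero_le_one, integral_Ioc_eq_integral_Ioo]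
  rw [setIntegral_congr_fun measurableSet_Ioo hgh]

theorem edgeInt_congr_segment {a b : E2} {g h : E2 → ℝ} (hgh : ∀ x ∈ segment ℝ a b, g x = h x) :
    edgeInt a b g = edgeInt a b h := by
  refine edgeInt_congr fun s hs => hgh _ ?_
  rw [segment_eq_image_lineMap]
  exact ⟨s, Set.Ioo_subset_Icc_self hs, rfl⟩

theorem edgeInt_zero (a b : E2) : edgeInt a b (fun _ => 0) = 0 := by simp [edgeInt]

/-- In the applications `g` is a square, possibly times a cutoff: an edge identity tested with the
jump itself makes the jump vanish pointwise. -/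
theorem eq_zero_of_edgeInt_eq_zero {a b : E2} (hab : a ≠ b) {g : E2 → ℝ} (hg : Continuous g)
    (h0 : ∀ x, 0 ≤ g x) (hint : edgeInt a b g = 0) : ∀ x ∈ segment ℝ a b, g x = 0 := by
  rw [segment_eq_image_lineMap]
  rintro _ ⟨s, hs, rfl⟩
  by_contra hne
  have hpos : 0 < ∫ t in (0 : ℝ)..1, g (AffineMap.lineMap a b t) :=
    intervalIntegral.integral_pos zero_lt_one (hg.comp (continuous_lineMap a b)).continuousOn
      (fun _ _ => h0 _) ⟨s, hs, (h0 _).lt_of_ne (Ne.symm hne)⟩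
  rw [edgeInt] at hint
  exact (mul_pos (dist_pos.2 hab) hpos).ne' hint

/-! ### Triangulations -/

theorem bary_lineMap (P : Fin 3 → E2) (i : Fin 3) (s : ℝ) :
    bary P i (AffineMap.lineMap (P (i + 1)) (P (i + 2)) s) = 0 ∧
    bary P (i + 1) (AffineMap.lineMap (P (i + 1)) (P (i + 2)) s) = (1 - s) * area2 P ∧
    bary P (i + 2) (AffineMap.lineMap (P (i + 1)) (P (i + 2)) s) = s * area2 P := by
  have e1 := bary_add_two P (i + 2)
  have e2 := bary_add_one P (i + 1)
  rw [show i + 2 + 2 = i + 1 by rw [add_assoc]; rfl] at e1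
  rw [show i + 1 + 1 = i + 2 by rw [add_assoc]; rfl] at e2
  simp only [AffineMap.lineMap_apply_module, bary_combo P _ _ _ (sub_add_cancel 1 s), bary_self,
    bary_add_one, bary_add_two, e1, e2]
  simp

/-- Near an inner point of an edge the triangle looks like the half-plane bounded by that edge. -/
theorem eventually_mem_interior_triangle {P : Fin 3 → E2} (hP : 0 < area2 P) (i : Fin 3) {x : E2}
    (h1 : 0 < bary P (i + 1) x) (h2 : 0 < bary P (i + 2) x) :
    ∀ᶠ y in nhds x, 0 < bary P i y → y ∈ interior (triangle P) := by
  filter_upwards [(continuous_bary P (i + 1)).continuousAt.eventually (lt_mem_nhds h1),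
    (continuous_bary P (i + 2)).continuousAt.eventually (lt_mem_nhds h2)] with y y1 y2 y0
  rw [mem_interior_triangle_iff hP]
  intro j
  rcases fin_three_cases i j with rfl | rfl | rfl
  exacts [y0, y1, y2]

/-- A finite family of triangles that form a conforming triangulation. -/
structure Triangulation (ι : Type*) where
  vert : ι → Fin 3 → E2
  ccw : ∀ τ, 0 < area2 (vert τ)
  conforming : ∀ σ τ, σ ≠ τ → MeetProperly (Set.range (vert σ)) (Set.range (vert τ))

namespace Triangulation

variable {ι : Type*} (𝒯 : Triangulation ι)

/-- The edge of the triangle `h.1` opposite to its vertex number `h.2`, with the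
counterclockwise orientation. -/
def halfEdge (h : ι × Fin 3) : E2 × E2 := (𝒯.vert h.1 (h.2 + 1), 𝒯.vert h.1 (h.2 + 2))

theorem halfEdge_ne (h : ι × Fin 3) : (𝒯.halfEdge h).1 ≠ (𝒯.halfEdge h).2 := by
  intro e
  have := vertex_injective (𝒯.ccw h.1) e
  simp at this

theorem swap_halfEdge_ne (h : ι × Fin 3) : (𝒯.halfEdge h).swap ≠ 𝒯.halfEdge h := fun e =>
  𝒯.halfEdge_ne h (congrArg Prod.snd e)

/-- Two counterclockwise triangles with the same oriented edge lie on the same side of it. They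
would overlap near its midpoint, against the disjointness of the interiors. Hence an edge belongs to
at most two triangles. -/
theorem halfEdge_injective : Function.Injective 𝒯.halfEdge := by
  rintro ⟨σ, i⟩ ⟨τ, j⟩ h
  simp only [halfEdge, Prod.mk.injEq] at h
  obtain ⟨hp, hq⟩ := h
  by_cases hστ : σ = τ
  · subst hστ
    have := vertex_injective (𝒯.ccw σ) hp
    rw [add_right_cancel this]
  exfalso
  obtain ⟨m0, m1, m2⟩ := bary_lineMap (𝒯.vert σ) i 2⁻¹
  obtain ⟨-, n1, n2⟩ := bary_lineMap (𝒯.vert τ) j 2⁻¹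
  rw [← hp, ← hq] at n1 n2
  set m := AffineMap.lineMap (𝒯.vert σ (i + 1)) (𝒯.vert σ (i + 2)) (2⁻¹ : ℝ)
  have hσ := 𝒯.ccw σ
  have hτ := 𝒯.ccw τ
  have heq : ∀ x, bary (𝒯.vert τ) j x = bary (𝒯.vert σ) i x := fun x => by
    rw [bary, bary, hp, hq]
  have hev := (eventually_mem_interior_triangle hσ i (x := m) (by rw [m1]; linarith)
    (by rw [m2]; linarith)).and (eventually_mem_interior_triangle hτ j (x := m)
    (by rw [n1]; linarith) (by rw [n2]; linarith))
  have hcont : Continuous fun t : ℝ => (1 - t) • m + t • 𝒯.vert σ i := by fun_prop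
  have h0 : (1 - (0 : ℝ)) • m + (0 : ℝ) • 𝒯.vert σ i = m := by simp
  rw [← h0] at hev
  have hev' := hcont.continuousAt.eventually hev
  obtain ⟨t, ⟨h1, h2⟩, ht0⟩ :=
    ((hev'.filter_mono nhdsWithin_le_nhds).and (self_mem_nhdsWithin (s := Set.Ioi (0 : ℝ)))).exists
  have hpos : 0 < bary (𝒯.vert σ) i ((1 - t) • m + t • 𝒯.vert σ i) := by
    rw [bary_combo _ _ _ _ (sub_add_cancel 1 t), m0, bary_self, mul_zero, zero_add]
    exact mul_pos ht0 hσ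
  exact Set.disjoint_left.1 (𝒯.conforming σ τ hστ).1 (h1 hpos) (h2 (by rw [heq]; exact hpos))

theorem fst_ne_of_halfEdge_eq_swap {h h' : ι × Fin 3}
    (e : 𝒯.halfEdge h' = (𝒯.halfEdge h).swap) : h'.1 ≠ h.1 := by
  obtain ⟨τ, i⟩ := h
  obtain ⟨σ, j⟩ := h'
  rintro rfl
  simp only [halfEdge, Prod.swap_prod_mk, Prod.mk.injEq] at e
  have h1 := vertex_injective (𝒯.ccw _) e.1
  have h2 := vertex_injective (𝒯.ccw _) e.2
  clear e
  revert h1 h2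
  revert i j
  decide

/-- A triangle that contains an inner point of an edge of another triangle shares that edge. -/
theorem exists_halfEdge_eq_swap {h : ι × Fin 3} {σ : ι} (hσ : σ ≠ h.1) {s : ℝ}
    (hs : s ∈ Set.Ioo (0 : ℝ) 1)
    (hx : AffineMap.lineMap (𝒯.halfEdge h).1 (𝒯.halfEdge h).2 s ∈ triangle (𝒯.vert σ)) :
    ∃ j, 𝒯.halfEdge (σ, j) = (𝒯.halfEdge h).swap := by
  obtain ⟨τ, i⟩ := h
  simp only [halfEdge] at hx hσ ⊢
  obtain ⟨m0, m1, m2⟩ := bary_lineMap (𝒯.vert τ) i s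
  set x := AffineMap.lineMap (𝒯.vert τ (i + 1)) (𝒯.vert τ (i + 2)) s
  have hτ := 𝒯.ccw τ
  have p1 : 0 < bary (𝒯.vert τ) (i + 1) x := m1 ▸ mul_pos (by linarith [hs.2]) hτ
  have p2 : 0 < bary (𝒯.vert τ) (i + 2) x := m2 ▸ mul_pos hs.1 hτ
  have hxτ : x ∈ triangle (𝒯.vert τ) := by
    rw [mem_triangle_iff hτ]
    intro j
    rcases fin_three_cases i j with rfl | rfl | rfl
    exacts [m0.ge, p1.le, p2.le]
  have hxx : x ∈ convexHull ℝ (Set.range (𝒯.vert σ) ∩ Set.range (𝒯.vert τ)) := by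
    rw [← (𝒯.conforming σ τ hσ).2]; exact ⟨hx, hxτ⟩
  -- By conformity `x` is a convex combination of common vertices. If vertex `l` of `τ` were not
  -- among them, the coordinate `l` would vanish at `x`.
  have hmem : ∀ l, 0 < bary (𝒯.vert τ) l x → 𝒯.vert τ l ∈ Set.range (𝒯.vert σ) := by
    intro l hl
    by_contra hnot
    have : x ∈ {y | bary (𝒯.vert τ) l y = 0} := by
      refine convexHull_min ?_ (convex_bary_eq_zero _ l) hxx
      rintro _ ⟨hy, ⟨j, rfl⟩⟩
      rcases fin_three_cases l j with rfl | rfl | rfl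
      exacts [(hnot hy).elim, bary_add_one _ _, bary_add_two _ _]
    exact hl.ne' this
  obtain ⟨a, ha⟩ := hmem _ p1
  obtain ⟨b, hb⟩ := hmem _ p2
  rcases fin_three_cases a b with rfl | rfl | rfl
  · have := vertex_injective hτ (ha.symm.trans hb)
    simp at this
  -- Equal orientation of the common edge is excluded by injectivity; the remaining case is the
  -- opposite one.
  · have : 𝒯.halfEdge (σ, a + 2) = 𝒯.halfEdge (τ, i) := by
      simp only [halfEdge, ← ha, ← hb, add_assoc]
      congr 2
      exact add_zero a
    exact (hσ (congrArg Prod.fst (𝒯.halfEdge_injective this))).elim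
  · refine ⟨a + 1, ?_⟩
    simp only [Prod.swap_prod_mk, ← ha, ← hb, add_assoc]
    congr 2
    exact add_zero a

/-- The region that is covered by the triangles. -/
def dom : Set E2 := interior (⋃ τ, triangle (𝒯.vert τ))

theorem eventually_notMem_triangle [Finite ι] (x : E2) :
    ∀ᶠ y in nhds x, ∀ ρ, x ∉ triangle (𝒯.vert ρ) → y ∉ triangle (𝒯.vert ρ) := by
  rw [Filter.eventually_all]
  intro ρ
  by_cases hx : x ∈ triangle (𝒯.vert ρ)
  · exact Filter.Eventually.of_forall fun y h => (h hx).elim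
  · filter_upwards [(isClosed_triangle (𝒯.vert ρ)).isOpen_compl.mem_nhds hx] with y hy _ using hy

/-- An edge that belongs to one triangle only is not inside the region. -/
theorem lineMap_notMem_dom [Finite ι] {h : ι × Fin 3}
    (hh : ∀ h', 𝒯.halfEdge h' ≠ (𝒯.halfEdge h).swap) {s : ℝ} (hs : s ∈ Set.Ioo (0 : ℝ) 1) :
    AffineMap.lineMap (𝒯.halfEdge h).1 (𝒯.halfEdge h).2 s ∉ 𝒯.dom := by
  intro hx
  -- No other triangle contains the point, so near it the region consists of the triangle `h.1`
  -- alone and the point would be interior to it, although one coordinate vanishes there.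
  have hint : AffineMap.lineMap (𝒯.halfEdge h).1 (𝒯.halfEdge h).2 s ∈
      interior (triangle (𝒯.vert h.1)) := by
    rw [mem_interior_iff_mem_nhds]
    filter_upwards [mem_interior_iff_mem_nhds.1 hx, 𝒯.eventually_notMem_triangle _] with y hy hy'
    obtain ⟨ρ, hρ⟩ := Set.mem_iUnion.1 hy
    by_cases hρτ : ρ = h.1
    · exact hρτ ▸ hρ
    · refine (hy' ρ (fun hxρ => ?_) hρ).elim
      obtain ⟨j, hj⟩ := 𝒯.exists_halfEdge_eq_swap hρτ hs hxρ
      exact hh _ hj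
  have h0 := (mem_interior_triangle_iff (𝒯.ccw h.1)).1 hint h.2
  rw [halfEdge, (bary_lineMap _ _ _).1] at h0
  exact h0.false

open Classical in
/-- In a sum over the oriented edges of all triangles, contributions that are opposite to each
other on shared edges cancel. -/
theorem sum_halfEdge_eq [Fintype ι] (F : ι × Fin 3 → ℝ)
    (hF : ∀ h h', 𝒯.halfEdge h' = (𝒯.halfEdge h).swap → F h + F h' = 0) :
    ∑ h, F h = ∑ h with ∀ h', 𝒯.halfEdge h' ≠ (𝒯.halfEdge h).swap, F h := by
  rw [← Finset.sum_filter_add_sum_filter_not Finset.univ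
    (fun h => ∀ h', 𝒯.halfEdge h' ≠ (𝒯.halfEdge h).swap), add_eq_left]
  have hex : ∀ h ∈ Finset.univ.filter
      (fun h => ¬ ∀ h', 𝒯.halfEdge h' ≠ (𝒯.halfEdge h).swap),
      ∃ h', 𝒯.halfEdge h' = (𝒯.halfEdge h).swap := fun h hh => by simpa using hh
  have hmem : ∀ h hh, (hex h hh).choose ∈ Finset.univ.filter
      (fun h => ¬ ∀ h', 𝒯.halfEdge h' ≠ (𝒯.halfEdge h).swap) := fun h hh => by
    simp only [Finset.mem_filter, Finset.mem_univ, true_and, not_forall, not_not]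
    exact ⟨h, by rw [(hex h hh).choose_spec, Prod.swap_swap]⟩
  -- The involution takes a half-edge to its opposite; that it is its own inverse is the injectivity
  -- of `halfEdge`.
  refine Finset.sum_involution (fun h hh => (hex h hh).choose)
    (fun h hh => hF _ _ (hex h hh).choose_spec) (fun h hh _ e => ?_) hmem fun h hh => ?_
  · have := (hex h hh).choose_spec
    rw [e] at this
    exact 𝒯.swap_halfEdge_ne h this.symm
  · refine 𝒯.halfEdge_injective ?_
    rw [(hex _ (hmem h hh)).choose_spec, (hex h hh).choose_spec, Prod.swap_swap]

/-! ### Piecewise polynomial fields -/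

/-- The integral of `(v · n) φ` over an edge of a triangle, with the outward normal. -/
def flux (v : ι → Fin 2 → Poly) (φ : E2 → ℝ) (h : ι × Fin 3) : ℝ :=
  edgeInt (𝒯.halfEdge h).1 (𝒯.halfEdge h).2
    (fun x => dotAt (v h.1) (rightNormal (𝒯.halfEdge h).1 (𝒯.halfEdge h).2) x * φ x)

/-- The normal components of `v` are continuous across all edges. -/
def NormalContinuous (v : ι → Fin 2 → Poly) : Prop :=
  ∀ h h', 𝒯.halfEdge h' = (𝒯.halfEdge h).swap →
    ∀ x ∈ segment ℝ (𝒯.halfEdge h).1 (𝒯.halfEdge h).2,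
      dotAt (v h.1) (rightNormal (𝒯.halfEdge h).1 (𝒯.halfEdge h).2) x =
        dotAt (v h'.1) (rightNormal (𝒯.halfEdge h).1 (𝒯.halfEdge h).2) x

theorem sum_integral_green [Fintype ι] (v : ι → Fin 2 → Poly) {φ : E2 → ℝ}
    (hφ : ContDiff ℝ 1 φ) :
    ∑ τ, ∫ x in triangle (𝒯.vert τ), (fderiv ℝ φ x (evV (v τ) x) + ev (divP (v τ)) x * φ x) =
      ∑ h, 𝒯.flux v φ h := by
  rw [Fintype.sum_prod_type]
  exact Finset.sum_congr rfl fun τ _ => integral_triangle_green (𝒯.ccw τ) (v τ) hφ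

theorem flux_add_flux {v : ι → Fin 2 → Poly} {φ : E2 → ℝ} (hφ : Continuous φ) {h h' : ι × Fin 3}
    (e : 𝒯.halfEdge h' = (𝒯.halfEdge h).swap) :
    𝒯.flux v φ h + 𝒯.flux v φ h' = edgeInt (𝒯.halfEdge h).1 (𝒯.halfEdge h).2 (fun x =>
      (dotAt (v h.1) (rightNormal (𝒯.halfEdge h).1 (𝒯.halfEdge h).2) x -
        dotAt (v h'.1) (rightNormal (𝒯.halfEdge h).1 (𝒯.halfEdge h).2) x) * φ x) := by
  rw [flux, flux, e, Prod.fst_swap, Prod.snd_swap, edgeInt_swap (𝒯.halfEdge h).1,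
    rightNormal_swap (𝒯.halfEdge h).1]
  refine (edgeInt_add _ _ ((continuous_dotAt _ _).mul hφ)
    ((continuous_dotAt _ _).mul hφ)).symm.trans ?_
  congr 1
  ext x
  rw [Pi.mul_apply, Pi.mul_apply, dotAt_neg]
  ring

theorem NormalContinuous.flux_add_flux {v : ι → Fin 2 → Poly} (hv : 𝒯.NormalContinuous v)
    {φ : E2 → ℝ} (hφ : Continuous φ) {h h' : ι × Fin 3}
    (e : 𝒯.halfEdge h' = (𝒯.halfEdge h).swap) : 𝒯.flux v φ h + 𝒯.flux v φ h' = 0 := by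
  rw [𝒯.flux_add_flux hφ e, ← edgeInt_zero (𝒯.halfEdge h).1 (𝒯.halfEdge h).2]
  exact edgeInt_congr_segment fun x hx => by rw [hv h h' e x hx, sub_self, zero_mul]

/-- In the sum of Green's formulas the shared edges cancel; the inner points of all other edges lie
outside the open region, where `φ` vanishes. -/
theorem NormalContinuous.sum_integral_eq_zero [Fintype ι] {v : ι → Fin 2 → Poly}
    (hv : 𝒯.NormalContinuous v) {φ : E2 → ℝ} (hφ : IsTest 𝒯.dom φ) :
    ∑ τ, ∫ x in triangle (𝒯.vert τ), (fderiv ℝ φ x (evV (v τ) x) + ev (divP (v τ)) x * φ x) =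
      0 := by
  classical
  rw [𝒯.sum_integral_green v (hφ.1.of_le (by simp)),
    𝒯.sum_halfEdge_eq _ fun h h' e => hv.flux_add_flux 𝒯 hφ.1.continuous e]
  refine Finset.sum_eq_zero fun h hh => ?_
  have hh' := (Finset.mem_filter.1 hh).2
  rw [flux, ← edgeInt_zero (𝒯.halfEdge h).1 (𝒯.halfEdge h).2]
  refine edgeInt_congr fun s hs => ?_
  rw [image_eq_zero_of_notMem_tsupport fun hx => 𝒯.lineMap_notMem_dom hh' hs (hφ.2.2 hx), mul_zero]

/-- The test function is the jump times a bump around an inner point of the edge, supported where no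
other edge is met. Green's formula leaves the edge integral of the bump times the squared jump, so
the jump is zero at the chosen point. -/
theorem normalContinuous_of_sum_integral_eq_zero [Fintype ι] {v : ι → Fin 2 → Poly}
    (hv : ∀ φ, IsTest 𝒯.dom φ → ∑ τ, ∫ x in triangle (𝒯.vert τ),
      (fderiv ℝ φ x (evV (v τ) x) + ev (divP (v τ)) x * φ x) = 0) :
    𝒯.NormalContinuous v := by
  intro h h' e
  set p := (𝒯.halfEdge h).1 with hp
  set q := (𝒯.halfEdge h).2 with hq
  set n := rightNormal p q
  let jump : E2 → ℝ := fun x => dotAt (v h.1) n x - dotAt (v h'.1) n x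
  have hjump : ContDiff ℝ ∞ jump := (contDiff_dotAt _ _).sub (contDiff_dotAt _ _)
  have hpq : p ≠ q := 𝒯.halfEdge_ne h
  have hne := 𝒯.fst_ne_of_halfEdge_eq_swap e
  have hep : (𝒯.halfEdge h').1 = q := by rw [e]; rfl
  have heq : (𝒯.halfEdge h').2 = p := by rw [e]; rfl
  -- The end points follow by closure.
  suffices hIoo : ∀ s ∈ Set.Ioo (0 : ℝ) 1, jump (AffineMap.lineMap p q s) = 0 by
    rw [segment_eq_image_lineMap]
    rintro _ ⟨s, hs, rfl⟩
    have hcl : IsClosed {s : ℝ | jump (AffineMap.lineMap p q s) = 0} :=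
      isClosed_eq (hjump.continuous.comp (continuous_lineMap p q)) continuous_const
    have := closure_minimal hIoo hcl
    rw [closure_Ioo zero_ne_one] at this
    exact sub_eq_zero.1 (this hs)
  intro s hs
  set x₀ : E2 := AffineMap.lineMap p q s with hx₀
  obtain ⟨-, m1, m2⟩ := bary_lineMap (𝒯.vert h.1) h.2 s
  obtain ⟨-, n1, n2⟩ := bary_lineMap (𝒯.vert h'.1) h'.2 (1 - s)
  have hx₀' : AffineMap.lineMap (𝒯.halfEdge h').1 (𝒯.halfEdge h').2 (1 - s) = x₀ := by
    rw [hep, heq, AffineMap.lineMap_apply_one_sub]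
  change bary _ _ x₀ = _ at m1 m2
  change bary _ _ (AffineMap.lineMap (𝒯.halfEdge h').1 (𝒯.halfEdge h').2 (1 - s)) = _ at n1 n2
  rw [hx₀'] at n1 n2
  have hτ := 𝒯.ccw h.1
  have hσ := 𝒯.ccw h'.1
  have hs0 := hs.1
  have hs1 : 0 < 1 - s := by linarith [hs.2]
  have hoth : ∀ ρ, ρ ≠ h.1 → ρ ≠ h'.1 → x₀ ∉ triangle (𝒯.vert ρ) := by
    intro ρ h1 h2 hx
    obtain ⟨j, hj⟩ := 𝒯.exists_halfEdge_eq_swap h1 hs hx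
    exact h2 (congrArg Prod.fst (𝒯.halfEdge_injective (hj.trans e.symm)))
  -- A neighbourhood that avoids all other triangles and, by positivity of the remaining
  -- coordinates, all other edges of the two neighbours.
  have hev : ∀ᶠ y in nhds x₀, (∀ ρ, ρ ≠ h.1 → ρ ≠ h'.1 → y ∉ triangle (𝒯.vert ρ)) ∧
      (0 < bary (𝒯.vert h.1) (h.2 + 1) y ∧ 0 < bary (𝒯.vert h.1) (h.2 + 2) y) ∧
      (0 < bary (𝒯.vert h'.1) (h'.2 + 1) y ∧ 0 < bary (𝒯.vert h'.1) (h'.2 + 2) y) := by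
    have hb : ∀ (P : Fin 3 → E2) i, 0 < bary P i x₀ → ∀ᶠ y in nhds x₀, 0 < bary P i y :=
      fun P i hi => (continuous_bary P i).continuousAt.eventually (lt_mem_nhds hi)
    filter_upwards [𝒯.eventually_notMem_triangle x₀, hb _ _ (m1 ▸ mul_pos hs1 hτ),
      hb _ _ (m2 ▸ mul_pos hs0 hτ), hb _ _ (n1 ▸ mul_pos (by linarith) hσ),
      hb _ _ (n2 ▸ mul_pos hs1 hσ)] with y y0 y1 y2 y3 y4
    exact ⟨fun ρ h1 h2 => y0 ρ (hoth ρ h1 h2), ⟨y1, y2⟩, y3, y4⟩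
  obtain ⟨r, hr, hball⟩ := Metric.eventually_nhds_iff_ball.1 hev
  let b : ContDiffBump x₀ := ⟨r / 4, r / 2, by linarith, by linarith⟩
  let φ : E2 → ℝ := fun x => b x * jump x
  have hφsupp : tsupport φ ⊆ Metric.ball x₀ r := by
    refine (tsupport_mul_subset_left (f := b) (g := jump)).trans ?_
    rw [b.tsupport_eq]
    exact Metric.closedBall_subset_ball (by change r / 2 < r; linarith)
  have hφ0 : ∀ x ∉ Metric.ball x₀ r, φ x = 0 := fun x hx =>
    image_eq_zero_of_notMem_tsupport fun h => hx (hφsupp h)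
  have hφ : IsTest 𝒯.dom φ := by
    refine ⟨b.contDiff.mul hjump, b.hasCompactSupport.mul_right, hφsupp.trans ?_⟩
    refine interior_maximal (fun x hx => ?_) Metric.isOpen_ball
    obtain ⟨-, ⟨x1, x2⟩, x3, x4⟩ := hball x hx
    -- The two neighbours lie on opposite sides of the edge, so one of them contains each point of
    -- the ball: the ball lies in the region.
    have hopp : bary (𝒯.vert h'.1) h'.2 x = - bary (𝒯.vert h.1) h.2 x := by
      change orient x (𝒯.halfEdge h').1 (𝒯.halfEdge h').2 = _
      rw [hep, heq, orient_swap]; rfl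
    rcases le_total 0 (bary (𝒯.vert h.1) h.2 x) with h0 | h0
    · refine Set.mem_iUnion.2 ⟨h.1, (mem_triangle_iff hτ).2 fun j => ?_⟩
      rcases fin_three_cases h.2 j with rfl | rfl | rfl
      exacts [h0, x1.le, x2.le]
    · refine Set.mem_iUnion.2 ⟨h'.1, (mem_triangle_iff hσ).2 fun j => ?_⟩
      rcases fin_three_cases h'.2 j with rfl | rfl | rfl
      exacts [by linarith, x3.le, x4.le]
  have hflux := hv φ hφ
  rw [𝒯.sum_integral_green v (hφ.1.of_le (by simp)), Fintype.sum_eq_add h h'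
    (fun hh => hne (by rw [hh])) ?_, 𝒯.flux_add_flux hφ.1.continuous e] at hflux
  · have hsq := eq_zero_of_edgeInt_eq_zero hpq (g := fun x => jump x * φ x)
      (hjump.continuous.mul hφ.1.continuous)
      (fun x => by
        have := mul_nonneg (b.nonneg (x := x)) (mul_self_nonneg (jump x))
        simp only [φ]; linarith) hflux x₀
      (by rw [segment_eq_image_lineMap]; exact ⟨s, Set.Ioo_subset_Icc_self hs, rfl⟩)
    have hb1 : b x₀ = 1 := b.one_of_mem_closedBall (Metric.mem_closedBall_self b.rIn_pos.le)
    simpa [φ, hb1] using hsq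
  · rintro ⟨ρ, l⟩ ⟨hk, hk'⟩
    rw [flux, ← edgeInt_zero (𝒯.halfEdge (ρ, l)).1 (𝒯.halfEdge (ρ, l)).2]
    refine edgeInt_congr fun t ht => ?_
    rw [hφ0, mul_zero]
    intro hx
    obtain ⟨y0, ⟨y1, y2⟩, y3, y4⟩ := hball _ hx
    obtain ⟨b0, b1, b2⟩ := bary_lineMap (𝒯.vert ρ) l t
    change bary _ _ (AffineMap.lineMap (𝒯.halfEdge (ρ, l)).1 (𝒯.halfEdge (ρ, l)).2 t) = _
      at b0 b1 b2
    by_cases h1 : ρ = h.1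
    · subst h1
      rcases fin_three_cases h.2 l with rfl | rfl | rfl
      exacts [hk rfl, y1.ne' b0, y2.ne' b0]
    by_cases h2 : ρ = h'.1
    · subst h2
      rcases fin_three_cases h'.2 l with rfl | rfl | rfl
      exacts [hk' rfl, y3.ne' b0, y4.ne' b0]
    refine y0 ρ h1 h2 ((mem_triangle_iff (𝒯.ccw ρ)).2 fun j => ?_)
    have := 𝒯.ccw ρ
    rcases fin_three_cases l j with rfl | rfl | rfl
    exacts [b0.ge, b1 ▸ mul_nonneg (by linarith [ht.2]) this.le, b2 ▸ mul_nonneg ht.1.le this.le]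

/-! ### Integrals over the region -/

theorem triangle_ae_eq_interior (P : Fin 3 → E2) :
    triangle P =ᵐ[volume] interior (triangle P) :=
  (interior_ae_eq_of_null_frontier ((convex_triangle P).addHaar_frontier volume)).symm

/-- Frontiers of convex sets are null, so edges do not matter for area integrals. -/
theorem dom_ae_eq [Finite ι] :
    (𝒯.dom : Set E2) =ᵐ[volume] ⋃ τ, interior (triangle (𝒯.vert τ)) := by
  have hU : (⋃ τ, triangle (𝒯.vert τ) : Set E2) =ᵐ[volume]
      (⋃ τ, interior (triangle (𝒯.vert τ)) : Set E2) :=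
    Filter.EventuallyEq.countable_iUnion fun τ => triangle_ae_eq_interior _
  have h1 : (⋃ τ, interior (triangle (𝒯.vert τ)) : Set E2) ⊆ 𝒯.dom :=
    Set.iUnion_subset fun τ => interior_mono (Set.subset_iUnion (fun τ => triangle (𝒯.vert τ)) τ)
  exact Filter.EventuallyLE.antisymm
    ((LE.le.eventuallyLE interior_subset).trans hU.le) h1.eventuallyLE

theorem pairwise_disjoint_interior :
    Pairwise fun σ τ => Disjoint (interior (triangle (𝒯.vert σ))) (interior (triangle (𝒯.vert τ))) :=
  fun σ τ h => (𝒯.conforming σ τ h).1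

theorem integrableOn_dom [Finite ι] {E : Type*} [NormedAddCommGroup E] {f : E2 → E}
    {F : ι → E2 → E} (hF : ∀ τ, Continuous (F τ))
    (hf : ∀ τ, ∀ x ∈ interior (triangle (𝒯.vert τ)), f x = F τ x) :
    IntegrableOn f 𝒯.dom := by
  rw [integrableOn_congr_set_ae 𝒯.dom_ae_eq, integrableOn_finite_iUnion]
  intro τ
  refine ((hF τ).continuousOn.integrableOn_compact (isCompact_triangle (𝒯.vert τ))).mono_set
    interior_subset |>.congr_fun (fun x hx => (hf τ x hx).symm) isOpen_interior.measurableSet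

theorem integral_dom [Fintype ι] {f : E2 → ℝ} {F : ι → E2 → ℝ} (hF : ∀ τ, Continuous (F τ))
    (hf : ∀ τ, ∀ x ∈ interior (triangle (𝒯.vert τ)), f x = F τ x) :
    ∫ x in 𝒯.dom, f x = ∑ τ, ∫ x in triangle (𝒯.vert τ), F τ x := by
  have hint := 𝒯.integrableOn_dom hF hf
  rw [integrableOn_congr_set_ae 𝒯.dom_ae_eq, integrableOn_finite_iUnion] at hint
  rw [setIntegral_congr_set 𝒯.dom_ae_eq, integral_iUnion_fintype
    (fun τ => isOpen_interior.measurableSet) 𝒯.pairwise_disjoint_interior hint]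
  refine Finset.sum_congr rfl fun τ _ => ?_
  rw [setIntegral_congr_fun isOpen_interior.measurableSet (hf τ),
    setIntegral_congr_set (triangle_ae_eq_interior (𝒯.vert τ))]

end Triangulation

/-! ### The triangulations of the subdomains -/

theorem fin_three_eq (i : Fin 3) : i = 0 ∨ i = 1 ∨ i = 2 := by
  revert i; decide

namespace SubMesh

variable {T : SubMesh}

/-- The vertices of a triangle, in counterclockwise order. -/
def vert (τ : T.Tri) : Fin 3 → E2 := ![ctr τ, va τ, vb τ]

theorem range_vert (τ : T.Tri) : Set.range (vert τ) = verts τ := by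
  simp only [vert, Matrix.range_cons, Matrix.range_empty, Set.union_empty, verts,
    PrimalCell.verts, ctr, va, vb]
  rfl

theorem triangle_vert (τ : T.Tri) : triangle (vert τ) = elt τ := by
  rw [triangle, range_vert, elt]

theorem area2_vert_pos (τ : T.Tri) : 0 < area2 (vert τ) := (T.cell τ.1).ccw τ.2

variable (T) in
/-- The triangulation of a subdomain. -/
def triang : Triangulation T.Tri where
  vert := vert
  ccw := area2_vert_pos
  conforming σ τ h := by
    rw [range_vert, range_vert]; exact T.conforming σ τ h

theorem triang_vert : T.triang.vert = vert := rfl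

theorem triang_dom : T.triang.dom = T.dom := by
  simp only [Triangulation.dom, triang_vert, triangle_vert, dom]

/-- The neighbour of `τ` across the dual edge `[ν, b]`. -/
def next (τ : T.Tri) : T.Tri := ⟨τ.1, finRotate _ τ.2⟩

theorem prev_next (τ : T.Tri) : prev (next τ) = τ := 
  Sigma.ext rfl (heq_of_eq (Equiv.symm_apply_apply _ _))

theorem next_prev (τ : T.Tri) : next (prev τ) = τ := 
  Sigma.ext rfl (heq_of_eq (Equiv.apply_symm_apply _ _))

/-- The permutation `prev` of the triangles. -/
def prevEquiv : T.Tri ≃ T.Tri := ⟨prev, next, next_prev, prev_next⟩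

theorem vb_prev (τ : T.Tri) : vb (prev τ) = va τ := 
  congrArg (T.cell τ.1).vertex (Equiv.apply_symm_apply _ _)

theorem halfEdge_zero (τ : T.Tri) : T.triang.halfEdge (τ, 0) = (va τ, vb τ) := rfl

theorem halfEdge_one (τ : T.Tri) : T.triang.halfEdge (τ, 1) = (vb τ, ctr τ) := rfl

theorem halfEdge_two (τ : T.Tri) : T.triang.halfEdge (τ, 2) = (ctr τ, va τ) := rfl

/-- The opposite of a dual edge is explicit and lies in the same primal element. As opposites are
unique, a dual edge is never a primal, interface or boundary edge. -/
theorem halfEdge_prev (τ : T.Tri) :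
    T.triang.halfEdge (prev τ, 1) = (T.triang.halfEdge (τ, 2)).swap := by
  rw [halfEdge_one, halfEdge_two, vb_prev]; rfl

theorem halfEdge_next (τ : T.Tri) :
    T.triang.halfEdge (next τ, 2) = (T.triang.halfEdge (τ, 1)).swap := by
  have := halfEdge_prev (next τ)
  rw [prev_next] at this
  rw [this, Prod.swap_swap]

theorem va_ne_vb (τ : T.Tri) : va τ ≠ vb τ := T.triang.halfEdge_ne (τ, 0)

end SubMesh

theorem MeetProperly.symm {V W : Set E2} (h : MeetProperly V W) : MeetProperly W V :=
  ⟨h.1.symm, by rw [Set.inter_comm, h.2, Set.inter_comm]⟩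

/-! ### Opposite half-edges and matching of normal components. -/

namespace Triangulation

variable {ι : Type*} (𝒯 : Triangulation ι)

/-- Unordered edges suffice in the definitions of the edge sets, since injectivity rules out equal
orientations. -/
theorem halfEdge_eq_swap_iff {h h' : ι × Fin 3} (hne : h ≠ h') :
    𝒯.halfEdge h' = (𝒯.halfEdge h).swap ↔
      s((𝒯.halfEdge h).1, (𝒯.halfEdge h).2) = s((𝒯.halfEdge h').1, (𝒯.halfEdge h').2) := by
  rw [Sym2.eq_iff, Prod.ext_iff]
  constructor
  · rintro ⟨h1, h2⟩; exact Or.inr ⟨h2.symm, h1.symm⟩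
  · rintro (⟨h1, h2⟩ | ⟨h1, h2⟩)
    · exact (hne (𝒯.halfEdge_injective (Prod.ext h1 h2))).elim
    · exact ⟨h2.symm, h1.symm⟩

/-- The edge opposite to a given oriented edge is unique. -/
theorem eq_of_halfEdge_eq_swap {h h' h'' : ι × Fin 3} (e' : 𝒯.halfEdge h' = (𝒯.halfEdge h).swap)
    (e'' : 𝒯.halfEdge h'' = (𝒯.halfEdge h).swap) : h' = h'' :=
  𝒯.halfEdge_injective (e'.trans e''.symm)

theorem halfEdge_eq_swap_symm {h h' : ι × Fin 3} (e : 𝒯.halfEdge h' = (𝒯.halfEdge h).swap) :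
    𝒯.halfEdge h = (𝒯.halfEdge h').swap := by rw [e, Prod.swap_swap]

/-- The normal component of `v` is continuous across the edge `h`, which is the edge `h'` of the
neighbour. -/
def NormalMatch (v : ι → Fin 2 → Poly) (h h' : ι × Fin 3) : Prop :=
  ∀ x ∈ segment ℝ (𝒯.halfEdge h).1 (𝒯.halfEdge h).2,
    dotAt (v h.1) (rightNormal (𝒯.halfEdge h).1 (𝒯.halfEdge h).2) x =
      dotAt (v h'.1) (rightNormal (𝒯.halfEdge h).1 (𝒯.halfEdge h).2) x

theorem NormalMatch.symm {v : ι → Fin 2 → Poly} {h h' : ι × Fin 3} (hm : 𝒯.NormalMatch v h h')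
    (e : 𝒯.halfEdge h' = (𝒯.halfEdge h).swap) : 𝒯.NormalMatch v h' h := by
  intro x hx
  rw [e, Prod.fst_swap, Prod.snd_swap] at hx ⊢
  rw [segment_symm] at hx
  rw [rightNormal_swap, dotAt_neg, dotAt_neg, hm x hx]

end Triangulation

namespace SubMesh

variable {T : SubMesh}

/-- A primal edge is not a dual edge. -/
theorem eq_zero_of_halfEdge_eq_swap {σ τ : T.Tri} {j : Fin 3}
    (e : T.triang.halfEdge (σ, j) = (T.triang.halfEdge (τ, 0)).swap) : j = 0 := by
  have e' := T.triang.halfEdge_eq_swap_symm e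
  obtain rfl | rfl | rfl := fin_three_eq j
  · rfl
  · have := T.triang.eq_of_halfEdge_eq_swap e' (halfEdge_next σ)
    simp at this
  · have := T.triang.eq_of_halfEdge_eq_swap e' (halfEdge_prev σ)
    simp at this

theorem primalEdge_eq_iff {σ τ : T.Tri} (hne : σ ≠ τ) : primalEdge σ = primalEdge τ ↔
    T.triang.halfEdge (τ, 0) = (T.triang.halfEdge (σ, 0)).swap :=
  (T.triang.halfEdge_eq_swap_iff (h := (σ, 0)) (h' := (τ, 0)) (by simpa using hne)).symm

/-- With a common center the two triangles would have opposite orientations. Hence the strict order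
of element numbers in `intEdges` misses no interior edge. -/
theorem cell_ne_of_halfEdge_eq_swap {σ τ : T.Tri}
    (e : T.triang.halfEdge (τ, 0) = (T.triang.halfEdge (σ, 0)).swap) : σ.1 ≠ τ.1 := by
  intro hc
  have hctr : ctr σ = ctr τ := by simp only [ctr, hc]
  simp only [halfEdge_zero, Prod.swap_prod_mk, Prod.mk.injEq] at e
  have h1 : 0 < orient (ctr σ) (va σ) (vb σ) := area2_vert_pos σ
  have h2 : 0 < orient (ctr τ) (va τ) (vb τ) := area2_vert_pos τ
  rw [e.1, e.2, ← hctr, orient_swap] at h2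
  linarith

theorem mem_intEdges {e : T.Tri × T.Tri} :
    e ∈ T.intEdges ↔ e.1.1 < e.2.1 ∧ primalEdge e.1 = primalEdge e.2 := by
  simp [intEdges]

theorem halfEdge_of_mem_intEdges {e : T.Tri × T.Tri} (he : e ∈ T.intEdges) :
    T.triang.halfEdge (e.2, 0) = (T.triang.halfEdge (e.1, 0)).swap := by
  obtain ⟨h1, h2⟩ := mem_intEdges.1 he
  exact (primalEdge_eq_iff fun h => h1.ne (by rw [h])).1 h2

theorem mem_intEdges_or {σ τ : T.Tri}
    (e : T.triang.halfEdge (τ, 0) = (T.triang.halfEdge (σ, 0)).swap) :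
    (σ, τ) ∈ T.intEdges ∨ (τ, σ) ∈ T.intEdges := by
  have hc := cell_ne_of_halfEdge_eq_swap e
  have hp := (primalEdge_eq_iff fun h => hc (by rw [h])).2 e
  rcases lt_or_gt_of_ne hc with h | h
  · exact Or.inl (mem_intEdges.2 ⟨h, hp⟩)
  · exact Or.inr (mem_intEdges.2 ⟨h, hp.symm⟩)

/-- Normal continuity across the dual edges and the interior primal edges. -/
theorem normalContinuous_of {v : T.Vect}
    (hd : ∀ τ : T.Tri, ∀ x ∈ segment ℝ (ctr τ) (va τ),
      dotAt (v τ) (nDl τ) x - dotAt (v (prev τ)) (nDl τ) x = 0)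
    (hp : ∀ e ∈ T.intEdges, ∀ x ∈ segment ℝ (va e.1) (vb e.1),
      dotAt (v e.1) (nPr e.1) x - dotAt (v e.2) (nPr e.1) x = 0) :
    T.triang.NormalContinuous v := by
  have hd' : ∀ τ : T.Tri, T.triang.NormalMatch v (τ, 2) (prev τ, 1) :=
    fun τ x hx => sub_eq_zero.1 (hd τ x hx)
  have hp' : ∀ e ∈ T.intEdges, T.triang.NormalMatch v (e.1, 0) (e.2, 0) :=
    fun e he x hx => sub_eq_zero.1 (hp e he x hx)
  suffices h : ∀ h h', T.triang.halfEdge h' = (T.triang.halfEdge h).swap →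
      T.triang.NormalMatch v h h' from h
  rintro ⟨τ, i⟩ ⟨σ, j⟩ e
  obtain rfl | rfl | rfl := fin_three_eq i
  · obtain rfl := eq_zero_of_halfEdge_eq_swap e
    rcases mem_intEdges_or e with h | h
    · exact hp' (τ, σ) h
    · exact (hp' (σ, τ) h).symm _ (T.triang.halfEdge_eq_swap_symm e)
  · obtain ⟨rfl, rfl⟩ := Prod.mk.inj (T.triang.eq_of_halfEdge_eq_swap e (halfEdge_next τ))
    have := hd' (next τ)
    rw [prev_next] at this
    exact this.symm _ (T.triang.halfEdge_eq_swap_symm e)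
  · obtain ⟨rfl, rfl⟩ := Prod.mk.inj (T.triang.eq_of_halfEdge_eq_swap e (halfEdge_prev τ))
    exact hd' τ

end SubMesh

/-! ### The triangulation of the whole domain -/

namespace Mesh

variable {M : Mesh}

variable (M) in
/-- The triangulation of the whole domain. -/
def triang : Triangulation (M.B.Tri ⊕ M.D.Tri) where
  vert := Sum.elim vert vert
  ccw := by rintro (τ | τ) <;> exact area2_vert_pos τ
  conforming := by
    rintro (σ | σ) (τ | τ) h <;> simp only [Sum.elim_inl, Sum.elim_inr, range_vert]
    · exact M.B.conforming σ τ fun e => h (by rw [e])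
    · exact M.conforming σ τ
    · exact (M.conforming τ σ).symm
    · exact M.D.conforming σ τ fun e => h (by rw [e])

theorem triang_vert : M.triang.vert = Sum.elim vert vert := rfl

theorem triang_dom : M.triang.dom = M.dom := by
  simp only [Triangulation.dom, triang_vert, Set.iUnion_sum, Sum.elim_inl, Sum.elim_inr,
    triangle_vert, dom]

/-- The edges that the two subdomains share are primal. -/
theorem eq_zero_of_halfEdge_eq_swap {σ : M.B.Tri} {τ : M.D.Tri} {i j : Fin 3}
    (e : M.D.triang.halfEdge (τ, j) = (M.B.triang.halfEdge (σ, i)).swap) : i = 0 ∧ j = 0 := by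
  have e1 : M.triang.halfEdge (Sum.inr τ, j) = (M.triang.halfEdge (Sum.inl σ, i)).swap := e
  have e2 := M.triang.halfEdge_eq_swap_symm e1
  constructor
  · obtain rfl | rfl | rfl := fin_three_eq i
    · rfl
    · have := M.triang.eq_of_halfEdge_eq_swap e1 (h'' := (Sum.inl (next σ), 2)) (halfEdge_next σ)
      simp at this
    · have := M.triang.eq_of_halfEdge_eq_swap e1 (h'' := (Sum.inl (prev σ), 1)) (halfEdge_prev σ)
      simp at this
  · obtain rfl | rfl | rfl := fin_three_eq j
    · rfl
    · have := M.triang.eq_of_halfEdge_eq_swap e2 (h'' := (Sum.inr (next τ), 2)) (halfEdge_next τ)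
      simp at this
    · have := M.triang.eq_of_halfEdge_eq_swap e2 (h'' := (Sum.inr (prev τ), 1)) (halfEdge_prev τ)
      simp at this

theorem primalEdge_eq_iff {σ : M.B.Tri} {τ : M.D.Tri} : primalEdge σ = primalEdge τ ↔
    M.D.triang.halfEdge (τ, 0) = (M.B.triang.halfEdge (σ, 0)).swap :=
  (M.triang.halfEdge_eq_swap_iff (h := (Sum.inl σ, 0)) (h' := (Sum.inr τ, 0)) (by simp)).symm

theorem mem_Γ {e : M.B.Tri × M.D.Tri} : e ∈ M.Γ ↔
    M.D.triang.halfEdge (e.2, 0) = (M.B.triang.halfEdge (e.1, 0)).swap := by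
  rw [← primalEdge_eq_iff]; simp [Γ]

theorem vert_of_mem_Γ {e : M.B.Tri × M.D.Tri} (he : e ∈ M.Γ) :
    va e.2 = vb e.1 ∧ vb e.2 = va e.1 := Prod.mk.inj (mem_Γ.1 he)

theorem nD_eq {e : M.B.Tri × M.D.Tri} (he : e ∈ M.Γ) : M.nD e = nPr e.2 := by
  rw [nD, nPr, nPr, (vert_of_mem_Γ he).1, (vert_of_mem_Γ he).2, rightNormal_swap, neg_neg]

/-- In the joint triangulation the unique opposite of an interface edge is in the Darcy region. -/
theorem halfEdge_ne_of_mem_Γ_fst {e : M.B.Tri × M.D.Tri} (he : e ∈ M.Γ) (τ : M.B.Tri) (j : Fin 3) :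
    M.B.triang.halfEdge (τ, j) ≠ (M.B.triang.halfEdge (e.1, 0)).swap := by
  intro h
  have := M.triang.eq_of_halfEdge_eq_swap (h := (Sum.inl e.1, 0)) (h' := (Sum.inl τ, j))
    (h'' := (Sum.inr e.2, 0)) h (mem_Γ.1 he)
  simp at this

theorem halfEdge_ne_of_mem_Γ_snd {e : M.B.Tri × M.D.Tri} (he : e ∈ M.Γ) (τ : M.D.Tri) (j : Fin 3) :
    M.D.triang.halfEdge (τ, j) ≠ (M.D.triang.halfEdge (e.2, 0)).swap := by
  intro h
  have := M.triang.eq_of_halfEdge_eq_swap (h := (Sum.inr e.2, 0)) (h' := (Sum.inr τ, j))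
    (h'' := (Sum.inl e.1, 0)) h (M.triang.halfEdge_eq_swap_symm (h := (Sum.inl e.1, 0))
      (h' := (Sum.inr e.2, 0)) (mem_Γ.1 he))
  simp at this

theorem eq_of_mem_Γ_of_fst_eq {e e' : M.B.Tri × M.D.Tri} (he : e ∈ M.Γ) (he' : e' ∈ M.Γ)
    (h : e.1 = e'.1) : e = e' := by
  rw [mem_Γ] at he he'
  rw [← h] at he'
  exact Prod.ext h (congrArg Prod.fst (M.D.triang.halfEdge_injective (he.trans he'.symm)))

theorem eq_of_mem_Γ_of_snd_eq {e e' : M.B.Tri × M.D.Tri} (he : e ∈ M.Γ) (he' : e' ∈ M.Γ)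
    (h : e.2 = e'.2) : e = e' := by
  rw [mem_Γ] at he he'
  rw [← h, he] at he'
  exact Prod.ext (congrArg Prod.fst
    (M.B.triang.halfEdge_injective (Prod.swap_injective he')) : (e.1, (0 : Fin 3)).1 = _) h

/-- The definition excludes only primal opposites; dual ones cannot occur, because an opposite of a
primal edge is primal. -/
theorem mem_ΓB {σ : M.B.Tri} : σ ∈ M.ΓB ↔
    (∀ h, M.B.triang.halfEdge h ≠ (M.B.triang.halfEdge (σ, 0)).swap) ∧
      ∀ τ : M.D.Tri, (σ, τ) ∉ M.Γ := by
  simp only [ΓB, Finset.mem_filter, Finset.mem_univ, true_and]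
  refine and_congr ⟨fun h => ?_, fun h τ hne => ?_⟩ (forall_congr' fun τ => ?_)
  · rintro ⟨τ, j⟩ e
    obtain rfl := SubMesh.eq_zero_of_halfEdge_eq_swap e
    have hc := cell_ne_of_halfEdge_eq_swap e
    exact h τ (fun h => hc (by rw [h])) ((SubMesh.primalEdge_eq_iff fun h => hc (by rw [h])).2 e).symm
  · exact fun e => h (τ, 0) ((SubMesh.primalEdge_eq_iff hne.symm).1 e.symm)
  · rw [mem_Γ, ← primalEdge_eq_iff, ne_comm]

theorem mem_ΓD {σ : M.D.Tri} : σ ∈ M.ΓD ↔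
    (∀ h, M.D.triang.halfEdge h ≠ (M.D.triang.halfEdge (σ, 0)).swap) ∧
      ∀ τ : M.B.Tri, (τ, σ) ∉ M.Γ := by
  simp only [ΓD, Finset.mem_filter, Finset.mem_univ, true_and]
  refine and_congr ⟨fun h => ?_, fun h τ hne => ?_⟩ (forall_congr' fun τ => ?_)
  · rintro ⟨τ, j⟩ e
    obtain rfl := SubMesh.eq_zero_of_halfEdge_eq_swap e
    have hc := cell_ne_of_halfEdge_eq_swap e
    exact h τ (fun h => hc (by rw [h])) ((SubMesh.primalEdge_eq_iff fun h => hc (by rw [h])).2 e).symm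
  · exact fun e => h (τ, 0) ((SubMesh.primalEdge_eq_iff hne.symm).1 e.symm)
  · rw [mem_Γ, ← primalEdge_eq_iff]

/-- Fields with continuous normal components on both subdomains and across the interface. -/
theorem normalContinuous_of {vB : M.B.Vect} {vD : M.D.Vect}
    (hB : M.B.triang.NormalContinuous vB) (hD : M.D.triang.NormalContinuous vD)
    (hΓ : ∀ e ∈ M.Γ, ∀ x ∈ segment ℝ (va e.1) (vb e.1),
      dotAt (vB e.1) (M.nD e) x = dotAt (vD e.2) (M.nD e) x) :
    M.triang.NormalContinuous (Sum.elim vB vD) := by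
  have hΓ' : ∀ e ∈ M.Γ, M.triang.NormalMatch (Sum.elim vB vD) (Sum.inl e.1, 0)
      (Sum.inr e.2, 0) := fun e he x hx => by
    have := hΓ e he x hx
    rw [nD, dotAt_neg, dotAt_neg] at this
    exact neg_injective this
  rintro ⟨τ | τ, i⟩ ⟨σ | σ, j⟩ e
  · exact hB (τ, i) (σ, j) e
  · obtain ⟨rfl, rfl⟩ := eq_zero_of_halfEdge_eq_swap (M := M) e
    exact hΓ' (τ, σ) (mem_Γ.2 e)
  · have e' := M.triang.halfEdge_eq_swap_symm e
    obtain ⟨rfl, rfl⟩ := eq_zero_of_halfEdge_eq_swap (M := M) e'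
    exact (hΓ' (σ, τ) (mem_Γ.2 e')).symm _ e'
  · exact hD (τ, i) (σ, j) e

end Mesh

/-! ### Degrees -/

theorem IsPk.add {k : ℕ} {p q : Poly} (hp : IsPk k p) (hq : IsPk k q) : IsPk k (p + q) :=
  (MvPolynomial.totalDegree_add p q).trans (max_le hp hq)

theorem IsPk.sub {k : ℕ} {p q : Poly} (hp : IsPk k p) (hq : IsPk k q) : IsPk k (p - q) :=
  (MvPolynomial.totalDegree_sub p q).trans (max_le hp hq)

theorem isPk_C (k : ℕ) (r : ℝ) : IsPk k (MvPolynomial.C r) := by simp [IsPk]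

theorem isPk_zero (k : ℕ) : IsPk k 0 := by simp [IsPk]

theorem IsPk.mul {k l : ℕ} {p q : Poly} (hp : IsPk k p) (hq : IsPk l q) : IsPk (k + l) (p * q) :=
  (MvPolynomial.totalDegree_mul p q).trans (add_le_add hp hq)

theorem IsPk.C_mul {k : ℕ} {p : Poly} (hp : IsPk k p) (r : ℝ) :
    IsPk k (MvPolynomial.C r * p) := by
  simpa using (isPk_C 0 r).mul hp

theorem IsPk.pderiv {k : ℕ} {p : Poly} (hp : IsPk k p) (i : Fin 2) :
    IsPk (k - 1) (MvPolynomial.pderiv i p) := by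
  refine Finset.sup_le fun m hm => ?_
  rw [MvPolynomial.mem_support_iff, MvPolynomial.coeff_pderiv] at hm
  have h := MvPolynomial.le_totalDegree (MvPolynomial.mem_support_iff.2 (left_ne_zero_of_mul hm))
  rw [Finsupp.sum_add_index' (fun _ => rfl) (fun _ _ _ => rfl),
    Finsupp.sum_single_index rfl] at h
  have hp' : p.totalDegree ≤ k := hp
  omega

theorem IsPk.divP {k : ℕ} {v : Fin 2 → Poly} (hv : ∀ i, IsPk k (v i)) : IsPk (k - 1) (divP v) := by
  rw [BrinkmanDarcy.divP, Fin.sum_univ_two]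
  exact ((hv 0).pderiv 0).add ((hv 1).pderiv 1)

/-- The polynomial `v · n`. -/
def dotP (v : Fin 2 → Poly) (n : E2) : Poly := ∑ i, MvPolynomial.C (n i) * v i

theorem ev_dotP (v : Fin 2 → Poly) (n x : E2) : ev (dotP v n) x = dotAt v n x := by
  simp only [dotP, dotAt, Fin.sum_univ_two, ev_add, ev_mul, ev_C]
  ring

theorem IsPk.dotP {k : ℕ} {v : Fin 2 → Poly} (hv : ∀ i, IsPk k (v i)) (n : E2) :
    IsPk k (dotP v n) := by
  rw [BrinkmanDarcy.dotP, Fin.sum_univ_two]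
  exact ((hv 0).C_mul _).add ((hv 1).C_mul _)

/-- The polynomial `bary P i`. -/
def baryP (P : Fin 3 → E2) (i : Fin 3) : Poly :=
  (MvPolynomial.C (P (i + 1) 0) - MvPolynomial.X 0) *
      MvPolynomial.C ((P (i + 2) - P (i + 1)) 1) -
    (MvPolynomial.C (P (i + 1) 1) - MvPolynomial.X 1) *
      MvPolynomial.C ((P (i + 2) - P (i + 1)) 0)

theorem ev_baryP (P : Fin 3 → E2) (i : Fin 3) (x : E2) : ev (baryP P i) x = bary P i x := by
  simp only [baryP, bary, orient, ev_sub, ev_mul, ev_C, ev_X, PiLp.sub_apply]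
  ring

theorem isPk_baryP (P : Fin 3 → E2) (i : Fin 3) : IsPk 1 (baryP P i) := by
  have hX : ∀ i : Fin 2, IsPk 1 (MvPolynomial.X i) := fun i => (MvPolynomial.totalDegree_X i).le
  have h : ∀ (i : Fin 2) (r s : ℝ),
      IsPk 1 ((MvPolynomial.C r - MvPolynomial.X i) * MvPolynomial.C s) := fun i r s =>
    ((isPk_C 1 r).sub (hX i)).mul (isPk_C 0 s)
  exact (h 0 _ _).sub (h 1 _ _)

/-! ### Weak divergences of piecewise polynomial fields -/

theorem HasWeakDiv.congr {O : Set E2} {v : E2 → E2} {g g' : E2 → ℝ} (h : HasWeakDiv O v g)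
    (hg : g =ᵐ[volume.restrict O] g') : HasWeakDiv O v g' := by
  intro φ hφ
  rw [h φ hφ, integral_congr_ae]
  filter_upwards [hg] with x hx
  rw [hx]

/-- Nonnegativity is asked on the triangle only, because a barycentric coordinate used as a weight
is negative elsewhere. -/
theorem eqOn_zero_of_integral_triangle_eq_zero {P : Fin 3 → E2} {g : E2 → ℝ} (hg : Continuous g)
    (h0 : ∀ x ∈ triangle P, 0 ≤ g x) (hint : ∫ x in triangle P, g x = 0) :
    Set.EqOn g 0 (interior (triangle P)) := by
  have hae : g =ᵐ[volume.restrict (triangle P)] 0 :=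
    (setIntegral_eq_zero_iff_of_nonneg_ae
      (ae_restrict_of_forall_mem (isClosed_triangle P).measurableSet h0)
      (hg.continuousOn.integrableOn_compact (isCompact_triangle P))).1 hint
  exact Measure.eqOn_open_of_ae_eq (ae_restrict_of_ae_restrict_of_subset interior_subset hae)
    isOpen_interior hg.continuousOn continuousOn_const

namespace Triangulation

variable {ι : Type*} (𝒯 : Triangulation ι)

/-- On each open triangle, `F` agrees with the given function. -/
def IsPiecewise {X : Type*} (F : E2 → X) (c : ι → E2 → X) : Prop :=
  ∀ τ, ∀ x ∈ interior (triangle (𝒯.vert τ)), F x = c τ x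

theorem interior_subset_dom (τ : ι) : interior (triangle (𝒯.vert τ)) ⊆ 𝒯.dom :=
  interior_mono (Set.subset_iUnion (fun τ => triangle (𝒯.vert τ)) τ)

theorem volume_dom_lt_top [Finite ι] : volume 𝒯.dom < ⊤ := by
  refine (measure_mono interior_subset).trans_lt ?_
  exact (isCompact_iUnion fun τ => isCompact_triangle (𝒯.vert τ)).measure_lt_top

theorem isFiniteMeasure_dom [Finite ι] : IsFiniteMeasure (volume.restrict 𝒯.dom) :=
  ⟨by rw [Measure.restrict_apply_univ]; exact 𝒯.volume_dom_lt_top⟩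

/-- A property that holds on all open triangles holds almost everywhere in the region. -/
theorem ae_restrict_dom [Finite ι] {p : E2 → Prop}
    (hp : ∀ τ, ∀ x ∈ interior (triangle (𝒯.vert τ)), p x) :
    ∀ᵐ x ∂volume.restrict 𝒯.dom, p x := by
  rw [Measure.restrict_congr_set 𝒯.dom_ae_eq]
  refine ae_restrict_of_forall_mem
    (MeasurableSet.iUnion fun τ => isOpen_interior.measurableSet) fun x hx => ?_
  obtain ⟨τ, hτ⟩ := Set.mem_iUnion.1 hx
  exact hp τ x hτ

theorem ae_restrict_triangle {p : E2 → Prop} (h : ∀ᵐ x ∂volume.restrict 𝒯.dom, p x) (τ : ι) :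
    ∀ᵐ x ∂volume.restrict (triangle (𝒯.vert τ)), p x := by
  rw [Measure.restrict_congr_set (triangle_ae_eq_interior (𝒯.vert τ))]
  exact ae_restrict_of_ae_restrict_of_subset (𝒯.interior_subset_dom τ) h

theorem IsPiecewise.memLp [Finite ι] {E : Type*} [NormedAddCommGroup E] {F : E2 → E}
    {c : ι → E2 → E} (hF : 𝒯.IsPiecewise F c) (hc : ∀ τ, Continuous (c τ)) (p : ENNReal) :
    MemLp F p (volume.restrict 𝒯.dom) := by
  have := 𝒯.isFiniteMeasure_dom
  choose C hC using fun τ =>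
    (isCompact_triangle (𝒯.vert τ)).exists_bound_of_continuousOn (hc τ).continuousOn
  obtain ⟨K, hK⟩ := Finite.exists_le C
  refine MemLp.of_bound (𝒯.integrableOn_dom hc hF).aestronglyMeasurable K
    (𝒯.ae_restrict_dom fun τ x hx => ?_)
  rw [hF τ x hx]
  exact (hC τ x (interior_subset hx)).trans (hK τ)

/-- Consequently a test function supported in the open triangles sees no edge flux. -/
theorem lineMap_notMem_interior (h : ι × Fin 3) (σ : ι) {s : ℝ} (hs : s ∈ Set.Ioo (0 : ℝ) 1) :
    AffineMap.lineMap (𝒯.halfEdge h).1 (𝒯.halfEdge h).2 s ∉ interior (triangle (𝒯.vert σ)) := by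
  intro hx
  have hpos := (mem_interior_triangle_iff (𝒯.ccw σ)).1 hx
  by_cases hσ : σ = h.1
  · subst hσ
    have := hpos h.2
    rw [halfEdge, (bary_lineMap _ _ _).1] at this
    exact this.false
  · obtain ⟨j, hj⟩ := 𝒯.exists_halfEdge_eq_swap hσ hs (interior_subset hx)
    have h0 := (bary_lineMap (𝒯.vert σ) j (1 - s)).1
    change bary _ _ (AffineMap.lineMap (𝒯.halfEdge (σ, j)).1 (𝒯.halfEdge (σ, j)).2 (1 - s)) = _
      at h0
    rw [hj, Prod.fst_swap, Prod.snd_swap, AffineMap.lineMap_apply_one_sub] at h0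
    exact (hpos j).ne' h0

variable [Fintype ι] {v : ι → Fin 2 → Poly} {F : E2 → E2} {G : E2 → ℝ}

theorem integral_dom_green (hF : 𝒯.IsPiecewise F fun τ => evV (v τ))
    (hG : 𝒯.IsPiecewise G fun τ => ev (divP (v τ))) {φ : E2 → ℝ} (hφ : ContDiff ℝ 1 φ) :
    (∫ x in 𝒯.dom, fderiv ℝ φ x (F x)) + ∫ x in 𝒯.dom, G x * φ x =
      ∑ τ, ∫ x in triangle (𝒯.vert τ), (fderiv ℝ φ x (evV (v τ) x) + ev (divP (v τ)) x * φ x) := by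
  rw [𝒯.integral_dom (fun τ => continuous_fderiv_evV hφ (v τ)) fun τ x hx => by rw [hF τ x hx],
    𝒯.integral_dom (fun τ => (continuous_ev (divP (v τ))).mul hφ.continuous)
      fun τ x hx => by rw [hG τ x hx]; rfl, ← Finset.sum_add_distrib]
  refine Finset.sum_congr rfl fun τ _ => (integral_add ?_ ?_).symm
  · exact (continuous_fderiv_evV hφ (v τ)).continuousOn.integrableOn_compact (isCompact_triangle _)
  · exact ((continuous_ev (divP (v τ))).mul hφ.continuous).continuousOn.integrableOn_compact
      (isCompact_triangle _)

/-- By Green's formula both sides state that the edge fluxes against every test function sum to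
zero. -/
theorem hasWeakDiv_iff (hF : 𝒯.IsPiecewise F fun τ => evV (v τ))
    (hG : 𝒯.IsPiecewise G fun τ => ev (divP (v τ))) :
    HasWeakDiv 𝒯.dom F G ↔ 𝒯.NormalContinuous v := by
  constructor
  · intro h
    refine 𝒯.normalContinuous_of_sum_integral_eq_zero fun φ hφ => ?_
    rw [← 𝒯.integral_dom_green hF hG (hφ.1.of_le (by simp)), h φ hφ, neg_add_cancel]
  · intro h φ hφ
    rw [eq_neg_iff_add_eq_zero, 𝒯.integral_dom_green hF hG (hφ.1.of_le (by simp))]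
    exact h.sum_integral_eq_zero 𝒯 hφ

/-- The weak divergence of a piecewise polynomial field is its piecewise divergence. -/
theorem ae_eq_of_hasWeakDiv (hF : 𝒯.IsPiecewise F fun τ => evV (v τ))
    (hG : 𝒯.IsPiecewise G fun τ => ev (divP (v τ))) {g : E2 → ℝ} (hg : IntegrableOn g 𝒯.dom)
    (h : HasWeakDiv 𝒯.dom F g) : g =ᵐ[volume.restrict 𝒯.dom] G := by
  set U := ⋃ τ, interior (triangle (𝒯.vert τ)) with hU
  have hUo : IsOpen U := isOpen_iUnion fun τ => isOpen_interior
  have hUd : U ⊆ 𝒯.dom := Set.iUnion_subset 𝒯.interior_subset_dom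
  have hGi : IntegrableOn G 𝒯.dom := 𝒯.integrableOn_dom (fun τ => continuous_ev _) hG
  have hae : ∀ᵐ x, x ∈ U → (g - G) x = 0 := by
    -- The fundamental lemma is applied on the union of the open triangles. Test functions there see
    -- no edge, so no continuity of normal components is needed.
    refine hUo.ae_eq_zero_of_integral_contDiff_smul_eq_zero
      ((hg.sub hGi).mono_set hUd).locallyIntegrableOn fun φ h1 h2 h3 => ?_
    have h1' : ContDiff ℝ 1 φ := h1.of_le (by simp)
    have hflux : ∑ h, 𝒯.flux v φ h = 0 := by
      refine Finset.sum_eq_zero fun h _ => ?_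
      rw [flux, ← edgeInt_zero (𝒯.halfEdge h).1 (𝒯.halfEdge h).2]
      refine edgeInt_congr fun s hs => ?_
      refine mul_eq_zero_of_right _ (image_eq_zero_of_notMem_tsupport fun hx => ?_)
      obtain ⟨σ, hσ⟩ := Set.mem_iUnion.1 (h3 hx)
      exact 𝒯.lineMap_notMem_interior h σ hs hσ
    rw [← 𝒯.sum_integral_green v h1', ← 𝒯.integral_dom_green hF hG h1',
      h φ ⟨h1, h2, h3.trans hUd⟩] at hflux
    have hb : ∀ {f : E2 → ℝ}, IntegrableOn f 𝒯.dom → IntegrableOn (fun x => f x * φ x) 𝒯.dom := by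
      intro f hf
      obtain ⟨C, hC⟩ := h1.continuous.bounded_above_of_compact_support h2
      exact hf.mul_bdd (c := C) h1.continuous.aestronglyMeasurable (Filter.Eventually.of_forall hC)
    have hsupp : ∀ x ∉ 𝒯.dom, φ x • (g - G) x = 0 := fun x hx => by
      rw [image_eq_zero_of_notMem_tsupport fun hx' => hx (hUd (h3 hx')), zero_smul]
    rw [← setIntegral_eq_integral_of_forall_compl_eq_zero hsupp]
    have : ∀ x, φ x • (g - G) x = g x * φ x - G x * φ x := fun x => by
      rw [Pi.sub_apply, smul_eq_mul]; ring
    simp only [this]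
    rw [integral_sub (hb hg) (hb hGi)]
    linarith
  rw [Measure.restrict_congr_set 𝒯.dom_ae_eq]
  refine (ae_restrict_iff' hUo.measurableSet).2 ?_
  filter_upwards [hae] with x hx hxU
  exact sub_eq_zero.1 (hx hxU)

end Triangulation

/-! ### Broken polynomials as functions on a subdomain. -/

namespace SubMesh

variable {T : SubMesh}

theorem sum_indicator_eq {X : Type*} [AddCommMonoid X] (c : T.Tri → E2 → X) {τ : T.Tri} {x : E2}
    (hx : x ∈ interior (elt τ)) : ∑ σ : T.Tri, (interior (elt σ)).indicator (c σ) x = c τ x := by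
  rw [Finset.sum_eq_single τ _ fun h => (h (Finset.mem_univ τ)).elim, Set.indicator_of_mem hx]
  intro σ _ hσ
  refine Set.indicator_of_notMem (fun hxσ => ?_) _
  exact Set.disjoint_left.1 (T.conforming σ τ hσ).1 hxσ hx

theorem isPiecewise_funV (v : T.Vect) : T.triang.IsPiecewise (funV v) fun τ => evV (v τ) := by
  intro τ x hx
  rw [triang_vert, triangle_vert] at hx
  exact sum_indicator_eq (fun τ => evV (v τ)) hx

theorem isPiecewise_funS (q : T.Scal) : T.triang.IsPiecewise (funS q) fun τ => ev (q τ) := by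
  intro τ x hx
  rw [triang_vert, triangle_vert] at hx
  exact sum_indicator_eq (fun τ => ev (q τ)) hx

theorem vol_eq (F : T.Tri → E2 → ℝ) : T.vol F = ∑ τ, ∫ x in triangle (vert τ), F τ x := by
  simp only [vol, triangle_vert]

theorem integral_dom_eq_vol {f : E2 → ℝ} {q : T.Scal} (hf : f =ᵐ[volume.restrict T.dom] funS q) :
    ∫ x in T.dom, f x = T.vol fun τ => ev (q τ) := by
  rw [integral_congr_ae hf, ← triang_dom,
    T.triang.integral_dom (fun τ => continuous_ev (q τ)) (isPiecewise_funS q), vol_eq, triang_vert]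

end SubMesh

namespace Mesh

variable {M : Mesh}

/-! ### The Darcy region -/

variable {k : ℕ} {ε : ℝ} {α K : E2 → Matrix (Fin 2) (Fin 2) ℝ} {fB fD : E2 → E2}
  {f g₁ g₂ : E2 → ℝ} {L : M.B.Tens} {uB : M.B.Vect} {pB : M.B.Scal} {uD : M.D.Vect}
  {pD : M.D.Scal}

/-- `H(div)`-conforming piecewise polynomials have continuous normal components, and their weak
divergence is the piecewise divergence. -/
theorem MemHD.normalContinuous {v : M.D.Vect} (h : M.MemHD k v) :
    M.D.triang.NormalContinuous v := by
  obtain ⟨-, g, hg, hw⟩ := h.hdiv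
  rw [← SubMesh.triang_dom] at hg hw
  have := M.D.triang.isFiniteMeasure_dom
  have hF := isPiecewise_funV v
  have hG := isPiecewise_funS fun τ => divP (v τ)
  -- Some weak divergence exists; it must be the piecewise one, and this forces the normal
  -- components to match.
  rw [← M.D.triang.hasWeakDiv_iff hF hG]
  exact hw.congr (M.D.triang.ae_eq_of_hasWeakDiv hF hG (hg.integrable one_le_two) hw)

theorem memHB_zero (k : ℕ) : M.MemHB k 0 :=
  ⟨fun _ _ => isPk_zero k, fun τ x _ => by simp [dotAt, ev_zero]⟩

theorem IsDiscreteSolution.Ah_eq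
    (hsol : M.IsDiscreteSolution k ε α K fB fD f g₁ g₂ L uB pB uD pD) {q : M.D.Scal}
    (hq : M.MemQD k q) : M.Ah uD q = M.D.vol (fun τ x => f x * ev (q τ) x) := by
  have h := hsol.eq2 0 q (memHB_zero k) hq
  simpa [Bh, bhStar, ev_zero, dotAt, sumInt, sumDual, vol, sumΓ, sumΓB, divP, edgeInt_zero]
    using h

/-- The difference of div u_D and the representative `q₀` of f has degree at most k - 1, so it is
admissible as its own test function and has zero norm. -/
theorem IsDiscreteSolution.divD_eq
    (hsol : M.IsDiscreteSolution k ε α K fB fD f g₁ g₂ L uB pB uD pD) {q₀ : M.D.Scal}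
    (hq₀ : M.MemQD k q₀) (hf : f =ᵐ[volume.restrict M.D.dom] funS q₀) (τ : M.D.Tri) :
    Set.EqOn (ev (divP (uD τ))) (ev (q₀ τ)) (interior (triangle (vert τ))) := by
  have hq : M.MemQD k fun τ => divP (uD τ) - q₀ τ := fun τ =>
    (IsPk.divP (hsol.memuD.poly τ)).sub (hq₀ τ)
  have h := hsol.Ah_eq hq
  rw [← SubMesh.triang_dom] at hf
  have hfτ : ∀ τ, f =ᵐ[volume.restrict (triangle (vert τ))] ev (q₀ τ) := by
    intro τ
    have h1 := M.D.triang.ae_restrict_triangle hf τ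
    have h2 := M.D.triang.ae_restrict_triangle
      (M.D.triang.ae_restrict_dom (p := fun x => ∀ τ, x ∈ interior (triangle (vert τ)) →
        funS q₀ x = ev (q₀ τ) x) fun σ x _ τ hx => isPiecewise_funS q₀ τ x hx) τ
    have h3 : ∀ᵐ x ∂volume.restrict (triangle (vert τ)), x ∈ interior (triangle (vert τ)) := by
      rw [Measure.restrict_congr_set (Triangulation.triangle_ae_eq_interior (vert τ))]
      exact ae_restrict_mem isOpen_interior.measurableSet
    filter_upwards [h1, h2, h3] with x x1 x2 x3
    rw [x1, x2 τ x3]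
  have hsum : ∑ τ : M.D.Tri, ∫ x in triangle (vert τ),
      ev ((divP (uD τ) - q₀ τ) * (divP (uD τ) - q₀ τ)) x = 0 := by
    rw [Ah, vol_eq, vol_eq, ← sub_eq_zero, ← Finset.sum_sub_distrib] at h
    rw [← h]
    refine Finset.sum_congr rfl fun τ _ => ?_
    have hint : ∀ p : Poly, IntegrableOn (ev p) (triangle (vert τ)) := fun p =>
      (continuous_ev p).continuousOn.integrableOn_compact (isCompact_triangle _)
    have h1 : ∫ x in triangle (vert τ), f x * ev (divP (uD τ) - q₀ τ) x =
        ∫ x in triangle (vert τ), ev (q₀ τ * (divP (uD τ) - q₀ τ)) x := by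
      refine integral_congr_ae ?_
      filter_upwards [hfτ τ] with x hx
      rw [hx, ev_mul]
    simp only [h1, ← ev_mul]
    rw [← integral_sub (hint _) (hint _)]
    congr 1
    ext x
    simp only [ev_mul, ev_sub]
    ring
  rw [Finset.sum_eq_zero_iff_of_nonneg fun τ _ => integral_nonneg fun x => by
    rw [ev_mul]; exact mul_self_nonneg _] at hsum
  have h0 := eqOn_zero_of_integral_triangle_eq_zero (continuous_ev _)
    (fun x _ => by rw [ev_mul]; exact mul_self_nonneg _) (hsum τ (Finset.mem_univ τ))
  intro x hx
  have := h0 hx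
  rw [ev_mul, ev_sub] at this
  exact sub_eq_zero.1 (mul_self_eq_zero.1 this)

theorem IsDiscreteSolution.ae_eq_div
    (hsol : M.IsDiscreteSolution k ε α K fB fD f g₁ g₂ L uB pB uD pD) {q₀ : M.D.Scal}
    (hq₀ : M.MemQD k q₀) (hf : f =ᵐ[volume.restrict M.D.dom] funS q₀) :
    f =ᵐ[volume.restrict M.D.dom] funS fun τ => divP (uD τ) := by
  refine hf.trans ?_
  rw [← SubMesh.triang_dom]
  refine M.D.triang.ae_restrict_dom fun τ x hx => ?_
  rw [isPiecewise_funS _ τ x hx, isPiecewise_funS _ τ x hx]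
  exact (hsol.divD_eq hq₀ hf τ hx).symm

theorem IsDiscreteSolution.hasWeakDivD
    (hsol : M.IsDiscreteSolution k ε α K fB fD f g₁ g₂ L uB pB uD pD)
    (hf : f =ᵐ[volume.restrict M.D.dom] funS fun τ => divP (uD τ)) :
    HasWeakDiv M.D.dom (funV uD) f := by
  refine HasWeakDiv.congr ?_ hf.symm
  rw [← SubMesh.triang_dom, M.D.triang.hasWeakDiv_iff (isPiecewise_funV uD) (isPiecewise_funS _)]
  exact hsol.memuD.toMemHD.normalContinuous

open Classical in
/-- The total flux through the boundary of the Darcy region is the integral of the divergence. -/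
theorem MemHD.sum_flux {v : M.D.Vect} (h : M.MemHD k v) :
    M.sumΓ (fun e => dotAt (v e.2) (M.nD e)) + M.sumΓD (fun σ => dotAt (v σ) (nPr σ)) =
      M.D.vol fun τ => ev (divP (v τ)) := by
  -- Green's formula with the constant test function; only half-edges without an opposite in the
  -- Darcy region survive.
  have hG := M.D.triang.sum_integral_green v (φ := fun _ => 1) contDiff_const
  have h1 : ∀ τ, (fun x : E2 => fderiv ℝ (fun _ : E2 => (1 : ℝ)) x (evV (v τ) x) +
      ev (divP (v τ)) x * 1) = ev (divP (v τ)) := fun τ => by ext x; simp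
  rw [M.D.triang.sum_halfEdge_eq _ fun h' h'' e =>
    h.normalContinuous.flux_add_flux _ continuous_const e] at hG
  simp only [h1] at hG
  rw [vol_eq, ← SubMesh.triang_vert, hG]
  -- Dual edges always have an opposite, so the surviving half-edges are primal and lie on Γ or on
  -- Γ_D.
  have hsplit : (Finset.univ.filter fun h : M.D.Tri × Fin 3 =>
      ∀ h', M.D.triang.halfEdge h' ≠ (M.D.triang.halfEdge h).swap) =
      (M.Γ.image fun e => (e.2, (0 : Fin 3))) ∪ M.ΓD.image fun σ => (σ, (0 : Fin 3)) := by
    ext ⟨σ, i⟩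
    simp only [Finset.mem_filter, Finset.mem_univ, true_and, Finset.mem_union, Finset.mem_image,
      Prod.mk.injEq]
    constructor
    · intro hσ
      obtain rfl | rfl | rfl := fin_three_eq i
      · by_cases hΓ : ∃ τ : M.B.Tri, (τ, σ) ∈ M.Γ
        · obtain ⟨τ, hτ⟩ := hΓ
          exact Or.inl ⟨(τ, σ), hτ, rfl, rfl⟩
        · exact Or.inr ⟨σ, mem_ΓD.2 ⟨hσ, fun τ hτ => hΓ ⟨τ, hτ⟩⟩, rfl, rfl⟩
      · exact (hσ _ (halfEdge_next σ)).elim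
      · exact (hσ _ (halfEdge_prev σ)).elim
    · rintro (⟨e, he, rfl, rfl⟩ | ⟨σ, hσ, rfl, rfl⟩)
      · exact fun h' => halfEdge_ne_of_mem_Γ_snd he h'.1 h'.2
      · exact (mem_ΓD.1 hσ).1
  rw [hsplit, Finset.sum_union, Finset.sum_image, Finset.sum_image, sumΓ, sumΓD]
  · congr 1
    · refine Finset.sum_congr rfl fun e he => ?_
      obtain ⟨ha, hb⟩ := vert_of_mem_Γ he
      rw [Triangulation.flux, halfEdge_zero, edgeInt_swap, nD_eq he, ← ha, ← hb]
      simp only [mul_one, nPr]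
    · refine Finset.sum_congr rfl fun e he => ?_
      rw [Triangulation.flux, halfEdge_zero]
      simp only [mul_one, nPr]
  · intro σ _ τ _ e
    exact (Prod.mk.inj e).1
  · intro e he e' he' h
    exact eq_of_mem_Γ_of_snd_eq he he' (Prod.mk.inj h).1
  · rw [Finset.disjoint_left]
    intro x hx hx'
    obtain ⟨e, he, rfl⟩ := Finset.mem_image.1 hx
    obtain ⟨σ, hσ, h⟩ := Finset.mem_image.1 hx'
    obtain rfl := (Prod.mk.inj h).1
    exact (mem_ΓD.1 hσ).2 e.1 he

end Mesh

/-! ### Integrable functions on edges -/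

/-- `g` is integrable on the segment `[a, b]`. -/
def EdgeIntegrable (a b : E2) (g : E2 → ℝ) : Prop :=
  IntervalIntegrable (fun t : ℝ => g (AffineMap.lineMap a b t)) volume 0 1

theorem MemL2Edge.edgeIntegrable {a b : E2} {g : E2 → ℝ} (h : MemL2Edge a b g) :
    EdgeIntegrable a b g := by
  rw [EdgeIntegrable, intervalIntegrable_iff_integrableOn_Icc_of_le zero_le_one]
  exact MemLp.integrable one_le_two h

theorem _root_.Continuous.edgeIntegrable {g : E2 → ℝ} (h : Continuous g) (a b : E2) :
    EdgeIntegrable a b g := (h.comp (continuous_lineMap a b)).intervalIntegrable _ _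

theorem EdgeIntegrable.mul_continuous {a b : E2} {g h : E2 → ℝ} (hg : EdgeIntegrable a b g)
    (hh : Continuous h) : EdgeIntegrable a b fun x => g x * h x :=
  hg.mul_continuousOn (hh.comp (continuous_lineMap a b)).continuousOn

theorem edgeInt_sub {a b : E2} {g h : E2 → ℝ} (hg : EdgeIntegrable a b g)
    (hh : EdgeIntegrable a b h) :
    edgeInt a b (fun x => g x - h x) = edgeInt a b g - edgeInt a b h := by
  rw [edgeInt, edgeInt, edgeInt, ← mul_sub, intervalIntegral.integral_sub hg hh]

theorem edgeInt_dotAt_add (a b : E2) (v w : Fin 2 → Poly) (m n : E2) (p q : Poly) :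
    edgeInt a b (fun x => dotAt v m x * ev p x) + edgeInt a b (fun x => dotAt w n x * ev q x) =
      edgeInt a b fun x => dotAt v m x * ev p x + dotAt w n x * ev q x :=
  (edgeInt_add a b ((continuous_dotAt v m).mul (continuous_ev p))
    ((continuous_dotAt w n).mul (continuous_ev q))).symm

theorem edgeInt_mul_const (a b : E2) (g : E2 → ℝ) (c : ℝ) :
    edgeInt a b (fun x => g x * c) = edgeInt a b g * c := by
  rw [edgeInt, edgeInt, intervalIntegral.integral_mul_const, mul_assoc]

theorem edgeInt_mul_ev_sub_C {a b : E2} {g : E2 → ℝ} (hg : EdgeIntegrable a b g) (p : Poly)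
    (c : ℝ) : edgeInt a b (fun x => g x * ev (p - MvPolynomial.C c) x) =
      edgeInt a b (fun x => g x * ev p x) - edgeInt a b g * c := by
  rw [← edgeInt_mul_const, ← edgeInt_sub (hg.mul_continuous (continuous_ev p))
    (hg.mul_continuous continuous_const)]
  simp only [ev_sub, ev_C, mul_sub]

theorem interior_triangle_nonempty {P : Fin 3 → E2} (hP : 0 < area2 P) :
    (interior (triangle P)).Nonempty := by
  refine ⟨param P (1 / 3, 1 / 3), (mem_interior_triangle_iff hP).2 fun i => ?_⟩
  obtain ⟨h0, h1, h2⟩ := bary_param P (1 / 3, 1 / 3)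
  obtain rfl | rfl | rfl := fin_three_eq i
  · rw [h0]; norm_num; exact hP
  · rw [h1]; norm_num; exact hP
  · rw [h2]; norm_num; exact hP

theorem integral_triangle_one_pos {P : Fin 3 → E2} (hP : 0 < area2 P) :
    0 < ∫ x in triangle P, ev 1 x := by
  refine (integral_nonneg fun x => (ev_one x).symm ▸ zero_le_one).lt_of_ne fun h => ?_
  obtain ⟨x, hx⟩ := interior_triangle_nonempty hP
  have := eqOn_zero_of_integral_triangle_eq_zero (continuous_ev 1)
    (fun x _ => (ev_one x).symm ▸ zero_le_one) h.symm hx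
  rw [ev_one] at this
  exact one_ne_zero this

theorem integrableOn_triangle_ev (P : Fin 3 → E2) (p : Poly) :
    IntegrableOn (ev p) (triangle P) :=
  (continuous_ev p).continuousOn.integrableOn_compact (isCompact_triangle P)

namespace Mesh

variable {M : Mesh} {k : ℕ}

/-! ### The Brinkman region -/

/-- Integration by parts in `b_h(v, q)`. -/
theorem MemHB.bh_eq {v : M.B.Vect} (hv : M.MemHB k v) (q : M.B.Scal) :
    M.bh v q = ∑ τ, edgeInt (va τ) (vb τ) (fun x => dotAt (v τ) (nPr τ) x * ev (q τ) x) -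
      M.B.vol fun τ x => ev (divP (v τ)) x * ev (q τ) x := by
  have hgreen : ∀ τ : M.B.Tri, ∫ x in triangle (vert τ),
      (∑ i, ev (v τ i) x * ev (MvPolynomial.pderiv i (q τ)) x) =
      edgeInt (va τ) (vb τ) (fun x => dotAt (v τ) (nPr τ) x * ev (q τ) x) +
      edgeInt (vb τ) (ctr τ) (fun x => dotAt (v τ) (rightNormal (vb τ) (ctr τ)) x * ev (q τ) x) +
      edgeInt (ctr τ) (va τ) (fun x => dotAt (v τ) (nDl τ) x * ev (q τ) x) -
      ∫ x in triangle (vert τ), ev (divP (v τ)) x * ev (q τ) x := by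
    intro τ
    have h := integral_triangle_green (area2_vert_pos τ) (v τ) ((contDiff_ev (q τ)).of_le (by simp))
    rw [integral_add, Fin.sum_univ_three] at h
    · refine Eq.trans ?_ (eq_sub_of_add_eq h)
      congr 1
      ext x
      rw [fderiv_ev]
      exact Finset.sum_congr rfl fun i _ => mul_comm _ _
    · exact (continuous_fderiv_evV ((contDiff_ev (q τ)).of_le (by simp))
        (v τ)).continuousOn.integrableOn_compact (isCompact_triangle _)
    · exact ((continuous_ev _).mul (continuous_ev _)).continuousOn.integrableOn_compact
        (isCompact_triangle _)
  -- Each dual edge occurs from `τ` and from `prev τ`. Reindexing by `prevEquiv` pairs the two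
  -- fluxes, and normal continuity of `v` turns them into one flux against the jump of `q`.
  have hdual : M.B.sumDual (fun τ x => dotAt (v τ) (nDl τ) x * (ev (q τ) x - ev (q (prev τ)) x)) =
      ∑ τ, edgeInt (ctr τ) (va τ) (fun x => dotAt (v τ) (nDl τ) x * ev (q τ) x) +
      ∑ τ, edgeInt (vb τ) (ctr τ)
        (fun x => dotAt (v τ) (rightNormal (vb τ) (ctr τ)) x * ev (q τ) x) := by
    rw [← Equiv.sum_comp prevEquiv (fun τ : M.B.Tri => edgeInt (vb τ) (ctr τ)
        (fun x => dotAt (v τ) (rightNormal (vb τ) (ctr τ)) x * ev (q τ) x)),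
      ← Finset.sum_add_distrib]
    refine Finset.sum_congr rfl fun τ _ => ?_
    change _ = _ + edgeInt (vb (prev τ)) (ctr τ) (fun x => dotAt (v (prev τ))
      (rightNormal (vb (prev τ)) (ctr τ)) x * ev (q (prev τ)) x)
    rw [vb_prev, edgeInt_swap (ctr τ) (va τ), rightNormal_swap (ctr τ) (va τ),
      edgeInt_dotAt_add]
    refine edgeInt_congr_segment fun x hx => ?_
    have := hv.dual τ x hx
    rw [dotAt_neg]
    change dotAt (v τ) (nDl τ) x * _ = dotAt (v τ) (nDl τ) x * _ + -dotAt _ (nDl τ) x * _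
    linear_combination (-ev (q (prev τ)) x) * this
  rw [bh, hdual, vol_eq, vol_eq, Finset.sum_congr rfl fun τ _ => hgreen τ, Finset.sum_sub_distrib,
    Finset.sum_add_distrib, Finset.sum_add_distrib]
  ring

theorem bh_sub_C (v : M.B.Vect) (q : M.B.Scal) (c : ℝ) :
    M.bh v (fun τ => q τ - MvPolynomial.C c) = M.bh v q := by
  simp only [bh, ev_sub, ev_C, sub_sub_sub_cancel_right, map_sub, MvPolynomial.pderiv_C, sub_zero]

theorem exists_memQ0_sub_C {q : M.B.Scal} (hq : M.MemQB k q) :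
    ∃ c : ℝ, M.MemQ0 k fun τ => q τ - MvPolynomial.C c := by
  have hmem : ∀ c : ℝ, M.MemQB k fun τ => q τ - MvPolynomial.C c := fun c =>
    ⟨fun τ => (hq.poly τ).sub (isPk_C k c), fun e he x hx => by
      simpa only [ev_sub, sub_sub_sub_cancel_right] using hq.primal e he x hx⟩
  -- Without triangles the area is zero and the mean value cannot be formed, but every constant
  -- works.
  rcases isEmpty_or_nonempty M.B.Tri with h | h
  · exact ⟨0, hmem 0, by simp [vol]⟩
  have hpos : 0 < M.B.vol fun _ => ev 1 := by
    rw [vol_eq]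
    exact Finset.sum_pos (fun τ _ => integral_triangle_one_pos (area2_vert_pos τ))
      Finset.univ_nonempty
  refine ⟨M.B.vol (fun τ => ev (q τ)) / M.B.vol (fun _ => ev 1), hmem _, ?_⟩
  set c := M.B.vol (fun τ => ev (q τ)) / M.B.vol (fun _ => ev 1) with hc
  have : M.B.vol (fun τ => ev (q τ - MvPolynomial.C c)) =
      M.B.vol (fun τ => ev (q τ)) - M.B.vol (fun _ => ev 1) * c := by
    simp only [vol_eq, Finset.sum_mul, ← Finset.sum_sub_distrib]
    refine Finset.sum_congr rfl fun τ _ => ?_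
    rw [← integral_mul_const, ← integral_sub (integrableOn_triangle_ev _ _)
      ((integrableOn_triangle_ev _ _).mul_const c)]
    simp only [ev_sub, ev_C, ev_one, one_mul]
  rw [this, hc, mul_div_cancel₀ _ hpos.ne', sub_self]

variable {ε : ℝ} {α K : E2 → Matrix (Fin 2) (Fin 2) ℝ} {fB fD : E2 → E2}
  {f g₁ g₂ : E2 → ℝ} {L : M.B.Tens} {uB : M.B.Vect} {pB : M.B.Scal} {uD : M.D.Vect}
  {pD : M.D.Scal}

/-- The projection onto P^k preserves the integral over an edge, as seen by testing with 1. -/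
theorem MemHDg.sumΓD_eq {v : M.D.Vect} {g : E2 → ℝ} (hv : M.MemHDg k g v)
    (hg : ∀ σ ∈ M.ΓD, MemL2Edge (va σ) (vb σ) g) :
    M.sumΓD (fun σ => dotAt (v σ) (nPr σ)) = M.sumΓD fun _ => g := by
  refine Finset.sum_congr rfl fun σ hσ => ?_
  have h := (hv.bdry σ hσ).2 1 (by simp [IsPk])
  simp only [ev_one, mul_one] at h
  rw [edgeInt_sub (hg σ hσ).edgeIntegrable ((continuous_dotAt _ _).edgeIntegrable _ _)] at h
  linarith

/-- The total flux through the interface. -/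
theorem IsDiscreteSolution.sumΓ_eq
    (hsol : M.IsDiscreteSolution k ε α K fB fD f g₁ g₂ L uB pB uD pD)
    (hf : f =ᵐ[volume.restrict M.D.dom] funS fun τ => divP (uD τ))
    (hg₂ : ∀ σ ∈ M.ΓD, MemL2Edge (va σ) (vb σ) g₂)
    (hcompat : M.sumΓB (fun _ => g₁) + M.sumΓD (fun _ => g₂) = ∫ x in M.D.dom, f x) :
    M.sumΓ (fun e => dotAt (uD e.2) (M.nD e)) = M.sumΓB fun _ => g₁ := by
  have h := hsol.memuD.toMemHD.sum_flux
  rw [hsol.memuD.sumΓD_eq hg₂, ← integral_dom_eq_vol hf, ← hcompat] at h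
  exact add_right_cancel h

/-- The third equation holds for all test functions in `Q_h^B`. -/
theorem IsDiscreteSolution.mass_eq
    (hsol : M.IsDiscreteSolution k ε α K fB fD f g₁ g₂ L uB pB uD pD)
    (hg₁ : ∀ σ ∈ M.ΓB, MemL2Edge (va σ) (vb σ) g₁)
    (hΓ : M.sumΓ (fun e => dotAt (uD e.2) (M.nD e)) = M.sumΓB fun _ => g₁)
    {q : M.B.Scal} (hq : M.MemQB k q) :
    M.Ih q uD + ∑ τ, edgeInt (va τ) (vb τ) (fun x => dotAt (uB τ) (nPr τ) x * ev (q τ) x) -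
      M.B.vol (fun τ x => ev (divP (uB τ)) x * ev (q τ) x) =
      M.sumΓB fun σ x => g₁ x * ev (q σ) x := by
  -- Subtracting `c` leaves b_h unchanged and alters the other two terms by `c` times the fluxes
  -- that `hΓ` equates.
  obtain ⟨c, hc⟩ := exists_memQ0_sub_C hq
  have h := hsol.eq3 _ hc
  have h1 : M.Ih (fun τ => q τ - MvPolynomial.C c) uD =
      M.Ih q uD - M.sumΓ (fun e => dotAt (uD e.2) (M.nD e)) * c := by
    simp only [Ih, sumΓ, Finset.sum_mul, ← Finset.sum_sub_distrib]
    exact Finset.sum_congr rfl fun e _ =>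
      edgeInt_mul_ev_sub_C ((continuous_dotAt _ _).edgeIntegrable _ _) _ _
  have h2 : M.sumΓB (fun σ x => g₁ x * ev (q σ - MvPolynomial.C c) x) =
      M.sumΓB (fun σ x => g₁ x * ev (q σ) x) - M.sumΓB (fun _ => g₁) * c := by
    simp only [sumΓB, Finset.sum_mul, ← Finset.sum_sub_distrib]
    exact Finset.sum_congr rfl fun σ hσ => edgeInt_mul_ev_sub_C (hg₁ σ hσ).edgeIntegrable _ _
  rw [bh_sub_C, h1, h2, hΓ, hsol.memuB.bh_eq] at h
  linarith

theorem bary_zero_of_mem_segment {T : SubMesh} {τ : T.Tri} {x : E2}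
    (hx : x ∈ segment ℝ (va τ) (vb τ)) : bary (vert τ) 0 x = 0 := by
  rw [segment_eq_image_lineMap] at hx
  obtain ⟨s, -, rfl⟩ := hx
  exact (bary_lineMap (vert τ) 0 s).1

/-- `∇ · u_{B,h} = 0` on each triangle. -/
theorem IsDiscreteSolution.divB_eq_zero
    (hsol : M.IsDiscreteSolution k ε α K fB fD f g₁ g₂ L uB pB uD pD) (hk : 1 ≤ k)
    (hg₁ : ∀ σ ∈ M.ΓB, MemL2Edge (va σ) (vb σ) g₁)
    (hΓ : M.sumΓ (fun e => dotAt (uD e.2) (M.nD e)) = M.sumΓB fun _ => g₁) (τ : M.B.Tri) :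
    Set.EqOn (ev (divP (uB τ))) 0 (interior (triangle (vert τ))) := by
  -- The weight is the coordinate of the center. It raises the degree from k - 1 to k, and since it
  -- vanishes on the primal edge, `q` is continuous across primal edges and all edge terms drop out.
  let q : M.B.Scal := fun τ => baryP (vert τ) 0 * divP (uB τ)
  have hq0 : ∀ τ : M.B.Tri, ∀ x ∈ segment ℝ (va τ) (vb τ), ev (q τ) x = 0 := fun τ x hx => by
    simp only [q, ev_mul, ev_baryP, bary_zero_of_mem_segment hx, zero_mul]
  have hq : M.MemQB k q := by
    refine ⟨fun τ => ?_, fun e he x hx => ?_⟩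
    · have := (isPk_baryP (vert τ) 0).mul (IsPk.divP (hsol.memuB.poly τ))
      rwa [Nat.add_sub_cancel' hk] at this
    · have h := halfEdge_of_mem_intEdges he
      simp only [halfEdge_zero, Prod.swap_prod_mk, Prod.mk.injEq] at h
      rw [hq0 e.1 x hx, hq0 e.2 x (by rwa [h.1, h.2, segment_symm]), sub_zero]
  have hzero : ∀ (g : E2 → ℝ) (τ : M.B.Tri),
      edgeInt (va τ) (vb τ) (fun x => g x * ev (q τ) x) = 0 := fun g τ => by
    rw [← edgeInt_zero (va τ) (vb τ)]
    exact edgeInt_congr_segment fun x hx => by rw [hq0 τ x hx, mul_zero]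
  have h := hsol.mass_eq hg₁ hΓ hq
  have hI : M.Ih q uD = 0 := Finset.sum_eq_zero fun e _ => hzero _ e.1
  have hS : M.sumΓB (fun σ x => g₁ x * ev (q σ) x) = 0 := Finset.sum_eq_zero fun σ _ => hzero _ σ
  have hE : ∑ τ, edgeInt (va τ) (vb τ) (fun x => dotAt (uB τ) (nPr τ) x * ev (q τ) x) = 0 :=
    Finset.sum_eq_zero fun τ _ => hzero _ τ
  have hnn : ∀ τ : M.B.Tri, ∀ x ∈ triangle (vert τ), 0 ≤ ev (divP (uB τ) * q τ) x := by
    intro τ x hx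
    have h1 := (mem_triangle_iff (area2_vert_pos τ)).1 hx 0
    have h2 := mul_nonneg h1 (mul_self_nonneg (ev (divP (uB τ)) x))
    simp only [q, ev_mul, ev_baryP]
    linarith
  rw [hI, hS, hE, vol_eq, add_zero, zero_sub, neg_eq_zero] at h
  simp only [← ev_mul] at h
  rw [Finset.sum_eq_zero_iff_of_nonneg fun τ _ =>
    setIntegral_nonneg (isClosed_triangle _).measurableSet (hnn τ)] at h
  intro x hx
  have h0 := eqOn_zero_of_integral_triangle_eq_zero (continuous_ev _) (hnn τ)
    (h τ (Finset.mem_univ τ)) hx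
  have hpos := (mem_interior_triangle_iff (area2_vert_pos τ)).1 hx 0
  simp only [q, ev_mul, ev_baryP, Pi.zero_apply] at h0
  rw [mul_left_comm] at h0
  exact mul_self_eq_zero.1 ((mul_eq_zero.1 h0).resolve_left hpos.ne')

open Classical in
/-- The mass balance on a set of triangles that contains, with a triangle, also its neighbour
across the primal edge. -/
theorem IsDiscreteSolution.mass_eq_of_finset
    (hsol : M.IsDiscreteSolution k ε α K fB fD f g₁ g₂ L uB pB uD pD) (hk : 1 ≤ k)
    (hg₁ : ∀ σ ∈ M.ΓB, MemL2Edge (va σ) (vb σ) g₁)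
    (hΓ : M.sumΓ (fun e => dotAt (uD e.2) (M.nD e)) = M.sumΓB fun _ => g₁)
    {S : Finset M.B.Tri} (hS : ∀ e ∈ M.B.intEdges, e.1 ∈ S ↔ e.2 ∈ S) {χ : Poly}
    (hχ : IsPk k χ) :
    ∑ e ∈ M.Γ with e.1 ∈ S, edgeInt (va e.1) (vb e.1)
        (fun x => dotAt (uD e.2) (M.nD e) x * ev χ x) +
      ∑ τ ∈ S, edgeInt (va τ) (vb τ) (fun x => dotAt (uB τ) (nPr τ) x * ev χ x) =
    ∑ σ ∈ M.ΓB with σ ∈ S, edgeInt (va σ) (vb σ) (fun x => g₁ x * ev χ x) := by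
  -- Continuity in Q_h^B is required across interior primal edges only, and `S` never separates the
  -- two sides of such an edge.
  let q : M.B.Scal := fun τ => if τ ∈ S then χ else 0
  have hq : M.MemQB k q := by
    refine ⟨fun τ => ?_, fun e he x _ => ?_⟩
    · simp only [q]; split_ifs
      exacts [hχ, isPk_zero k]
    · simp only [q, hS e he, sub_self]
  have hedge : ∀ (g : E2 → ℝ) (τ : M.B.Tri),
      edgeInt (va τ) (vb τ) (fun x => g x * ev (q τ) x) =
      if τ ∈ S then edgeInt (va τ) (vb τ) (fun x => g x * ev χ x) else 0 := fun g τ => by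
    simp only [q]; split_ifs
    · rfl
    · simp only [ev_zero, mul_zero, edgeInt_zero]
  have hvol : M.B.vol (fun τ x => ev (divP (uB τ)) x * ev (q τ) x) = 0 := by
    rw [vol_eq]
    refine Finset.sum_eq_zero fun τ _ => ?_
    rw [setIntegral_congr_set (Triangulation.triangle_ae_eq_interior (vert τ))]
    refine setIntegral_eq_zero_of_forall_eq_zero fun x hx => ?_
    rw [hsol.divB_eq_zero hk hg₁ hΓ τ hx, Pi.zero_apply, zero_mul]
  have h := hsol.mass_eq hg₁ hΓ hq
  rw [hvol, sub_zero] at h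
  simp only [Ih, sumΓ, sumΓB, hedge] at h
  rw [Finset.sum_filter, Finset.sum_filter, ← h, Finset.sum_ite_mem, Finset.univ_inter]

/-- The normal component of `u_{B,h}` is continuous across the interior primal edges. -/
theorem IsDiscreteSolution.primal_jump_eq_zero
    (hsol : M.IsDiscreteSolution k ε α K fB fD f g₁ g₂ L uB pB uD pD) (hk : 1 ≤ k)
    (hg₁ : ∀ σ ∈ M.ΓB, MemL2Edge (va σ) (vb σ) g₁)
    (hΓ : M.sumΓ (fun e => dotAt (uD e.2) (M.nD e)) = M.sumΓB fun _ => g₁)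
    {e : M.B.Tri × M.B.Tri} (he : e ∈ M.B.intEdges) {x : E2}
    (hx : x ∈ segment ℝ (va e.1) (vb e.1)) :
    dotAt (uB e.1) (nPr e.1) x - dotAt (uB e.2) (nPr e.1) x = 0 := by
  classical
  have hs := halfEdge_of_mem_intEdges he
  have hs' := M.B.triang.halfEdge_eq_swap_symm hs
  have hne : e.1 ≠ e.2 := fun h => (mem_intEdges.1 he).1.ne (by rw [h])
  -- Each triangle has a single primal edge with a unique neighbour, so the pair is closed under
  -- taking neighbours.
  have hS : ∀ e' ∈ M.B.intEdges,
      e'.1 ∈ ({e.1, e.2} : Finset M.B.Tri) ↔ e'.2 ∈ ({e.1, e.2} : Finset M.B.Tri) := by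
    intro e' he'
    have ht := halfEdge_of_mem_intEdges he'
    have ht' := M.B.triang.halfEdge_eq_swap_symm ht
    simp only [Finset.mem_insert, Finset.mem_singleton]
    constructor
    · rintro (h | h) <;> rw [h] at ht
      · exact Or.inr (Prod.mk.inj (M.B.triang.eq_of_halfEdge_eq_swap ht hs)).1
      · exact Or.inl (Prod.mk.inj (M.B.triang.eq_of_halfEdge_eq_swap ht hs')).1
    · rintro (h | h) <;> rw [h] at ht'
      · exact Or.inr (Prod.mk.inj (M.B.triang.eq_of_halfEdge_eq_swap ht' hs)).1
      · exact Or.inl (Prod.mk.inj (M.B.triang.eq_of_halfEdge_eq_swap ht' hs')).1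
  -- The jump itself is the test polynomial; the mass balance on the pair then says that its square
  -- has zero integral over the edge.
  let χ : Poly := dotP (uB e.1) (nPr e.1) - dotP (uB e.2) (nPr e.1)
  have hχ : IsPk k χ :=
    (IsPk.dotP (hsol.memuB.poly _) _).sub (IsPk.dotP (hsol.memuB.poly _) _)
  have hev : ∀ x, ev χ x = dotAt (uB e.1) (nPr e.1) x - dotAt (uB e.2) (nPr e.1) x := fun x => by
    simp only [χ, ev_sub, ev_dotP]
  have h := hsol.mass_eq_of_finset hk hg₁ hΓ hS hχ
  rw [Finset.filter_false_of_mem, Finset.filter_false_of_mem, Finset.sum_empty, Finset.sum_empty,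
    zero_add, Finset.sum_pair hne] at h
  · have hab := Prod.mk.inj hs
    have h2 : nPr e.2 = - nPr e.1 := by
      rw [nPr, nPr, rightNormal_swap (vb e.1), neg_neg]; exact congrArg₂ _ hab.1 hab.2
    rw [show va e.2 = vb e.1 from hab.1, show vb e.2 = va e.1 from hab.2,
      edgeInt_swap (va e.1) (vb e.1), h2,
      edgeInt_dotAt_add] at h
    have h0 := eq_zero_of_edgeInt_eq_zero (va_ne_vb e.1) (g := fun x => ev χ x * ev χ x)
      ((continuous_ev χ).mul (continuous_ev χ)) (fun x => mul_self_nonneg _) ?_ x hx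
    · rw [← hev]; exact mul_self_eq_zero.1 h0
    · rw [← h]
      congr 1
      ext x
      rw [dotAt_neg, hev]
      ring
  · intro σ hσ
    simp only [Finset.mem_insert, Finset.mem_singleton]
    rintro (rfl | rfl)
    · exact (mem_ΓB.1 hσ).1 _ hs
    · exact (mem_ΓB.1 hσ).1 _ hs'
  · intro e' he'
    simp only [Finset.mem_insert, Finset.mem_singleton]
    rintro (h | h)
    · exact halfEdge_ne_of_mem_Γ_fst he' e.2 0 (by rw [h]; exact hs)
    · exact halfEdge_ne_of_mem_Γ_fst he' e.1 0 (by rw [h]; exact hs')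

/-- Applies to triangles whose primal edge is on Γ or Γ_B, where the mass balance can be localised
to one triangle. -/
theorem singleton_closed {σ : M.B.Tri}
    (hσ : ∀ τ, M.B.triang.halfEdge (τ, 0) ≠ (M.B.triang.halfEdge (σ, 0)).swap) :
    ∀ e ∈ M.B.intEdges, e.1 ∈ ({σ} : Finset M.B.Tri) ↔ e.2 ∈ ({σ} : Finset M.B.Tri) := by
  intro e he
  have hs := halfEdge_of_mem_intEdges he
  have hs' := M.B.triang.halfEdge_eq_swap_symm hs
  simp only [Finset.mem_singleton]
  constructor
  · rintro rfl; exact (hσ _ hs).elim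
  · rintro rfl; exact (hσ _ hs').elim

/-- The interface condition. -/
theorem IsDiscreteSolution.interface
    (hsol : M.IsDiscreteSolution k ε α K fB fD f g₁ g₂ L uB pB uD pD) (hk : 1 ≤ k)
    (hg₁ : ∀ σ ∈ M.ΓB, MemL2Edge (va σ) (vb σ) g₁)
    (hΓ : M.sumΓ (fun e => dotAt (uD e.2) (M.nD e)) = M.sumΓB fun _ => g₁)
    {e : M.B.Tri × M.D.Tri} (he : e ∈ M.Γ) {x : E2} (hx : x ∈ segment ℝ (va e.1) (vb e.1)) :
    dotAt (uB e.1) (M.nD e) x = dotAt (uD e.2) (M.nD e) x := by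
  classical
  -- The outward normal of the Brinkman triangle is -n_D, so the balance on this triangle tests
  -- exactly the mismatch `χ` of the normal components.
  let χ : Poly := dotP (uD e.2) (M.nD e) - dotP (uB e.1) (M.nD e)
  have hχ : IsPk k χ :=
    (IsPk.dotP (hsol.memuD.poly _) _).sub (IsPk.dotP (hsol.memuB.poly _) _)
  have hev : ∀ x, ev χ x = dotAt (uD e.2) (M.nD e) x - dotAt (uB e.1) (M.nD e) x := fun x => by
    simp only [χ, ev_sub, ev_dotP]
  have h := hsol.mass_eq_of_finset hk hg₁ hΓ
    (singleton_closed fun τ => halfEdge_ne_of_mem_Γ_fst he τ 0) hχ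
  have hf1 : M.Γ.filter (fun e' => e'.1 ∈ ({e.1} : Finset M.B.Tri)) = {e} := by
    ext e'
    simp only [Finset.mem_filter, Finset.mem_singleton]
    constructor
    · rintro ⟨he', h⟩; exact eq_of_mem_Γ_of_fst_eq he' he h
    · rintro rfl; exact ⟨he, rfl⟩
  rw [hf1, Finset.filter_false_of_mem (s := M.ΓB), Finset.sum_empty, Finset.sum_singleton,
    Finset.sum_singleton, edgeInt_dotAt_add] at h
  · have h0 := eq_zero_of_edgeInt_eq_zero (va_ne_vb e.1) (g := fun x => ev χ x * ev χ x)
      ((continuous_ev χ).mul (continuous_ev χ)) (fun x => mul_self_nonneg _) ?_ x hx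
    · have := mul_self_eq_zero.1 h0
      rw [hev] at this
      linarith
    · rw [← h]
      congr 1
      ext x
      rw [hev, nD, dotAt_neg, dotAt_neg]
      ring
  · intro σ hσ hσ'
    obtain rfl := Finset.mem_singleton.1 hσ'
    exact (mem_ΓB.1 hσ).2 e.2 he

/-- The boundary condition on `Γ_B`. -/
theorem IsDiscreteSolution.isEdgeProj
    (hsol : M.IsDiscreteSolution k ε α K fB fD f g₁ g₂ L uB pB uD pD) (hk : 1 ≤ k)
    (hg₁ : ∀ σ ∈ M.ΓB, MemL2Edge (va σ) (vb σ) g₁)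
    (hΓ : M.sumΓ (fun e => dotAt (uD e.2) (M.nD e)) = M.sumΓB fun _ => g₁)
    {σ : M.B.Tri} (hσ : σ ∈ M.ΓB) :
    IsEdgeProj k (va σ) (vb σ) g₁ (dotAt (uB σ) (nPr σ)) := by
  classical
  refine ⟨⟨dotP (uB σ) (nPr σ), IsPk.dotP (hsol.memuB.poly σ) _,
    fun x _ => (ev_dotP _ _ _).symm⟩, fun χ hχ => ?_⟩
  -- On a single triangle at Γ_B the balance is the orthogonality that defines the projection.
  have h := hsol.mass_eq_of_finset hk hg₁ hΓ
    (singleton_closed fun τ => (mem_ΓB.1 hσ).1 (τ, 0)) hχ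
  have hf2 : M.ΓB.filter (fun τ => τ ∈ ({σ} : Finset M.B.Tri)) = {σ} := by
    ext τ
    simp only [Finset.mem_filter, Finset.mem_singleton]
    exact ⟨And.right, fun h => ⟨h ▸ hσ, h⟩⟩
  rw [hf2, Finset.filter_false_of_mem (s := M.Γ), Finset.sum_empty, Finset.sum_singleton,
    Finset.sum_singleton, zero_add] at h
  · simp only [sub_mul]
    rw [edgeInt_sub ((hg₁ σ hσ).edgeIntegrable.mul_continuous (continuous_ev χ))
      (((continuous_dotAt _ _).edgeIntegrable _ _).mul_continuous (continuous_ev χ)), ← h]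
    exact sub_self _
  · intro e he hσ'
    obtain rfl := Finset.mem_singleton.1 hσ'
    exact (mem_ΓB.1 hσ).2 e.2 he

end Mesh

/-! ### Integrals against test functions and normal traces. -/

theorem IsTest.integrableOn_fderiv_apply {U O : Set E2} {φ : E2 → ℝ} (hφ : IsTest U φ)
    {v : E2 → E2} (hv : IntegrableOn v O) : IntegrableOn (fun x => fderiv ℝ φ x (v x)) O := by
  simp only [clm_apply_eq _ (v _)]
  refine integrable_finsetSum _ fun i _ => ?_
  have hc : Continuous fun x => fderiv ℝ φ x (EuclideanSpace.single i 1) :=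
    (hφ.1.continuous_fderiv (by simp)).clm_apply continuous_const
  obtain ⟨C, hC⟩ := hc.bounded_above_of_compact_support
    (hφ.2.1.fderiv_apply (𝕜 := ℝ) (EuclideanSpace.single i 1))
  have hvi : IntegrableOn (fun x => v x i) O :=
    (EuclideanSpace.proj (𝕜 := ℝ) i : E2 →L[ℝ] ℝ).integrable_comp hv
  exact hvi.mul_bdd (c := C) hc.aestronglyMeasurable (Filter.Eventually.of_forall hC)

theorem IsTest.integrableOn_mul {U O : Set E2} {φ : E2 → ℝ} (hφ : IsTest U φ)
    {g : E2 → ℝ} (hg : IntegrableOn g O) : IntegrableOn (fun x => g x * φ x) O := by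
  obtain ⟨C, hC⟩ := hφ.1.continuous.bounded_above_of_compact_support hφ.2.1
  exact hg.mul_bdd (c := C) hφ.1.continuous.aestronglyMeasurable (Filter.Eventually.of_forall hC)

theorem IsTest.normalTrace_eq {U O : Set E2} {φ : E2 → ℝ} (hφ : IsTest U φ) {v : E2 → E2}
    {g : E2 → ℝ} (hv : IntegrableOn v O) (hg : IntegrableOn g O) :
    normalTrace O v g φ = (∫ x in O, fderiv ℝ φ x (v x)) + ∫ x in O, g x * φ x :=
  integral_add (hφ.integrableOn_fderiv_apply hv) (hφ.integrableOn_mul hg)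

namespace Mesh

variable {M : Mesh}

/-! ### The whole domain -/

theorem dom_ae_eq : (M.dom : Set E2) =ᵐ[volume] (M.B.dom ∪ M.D.dom : Set E2) := by
  have h := M.triang.dom_ae_eq
  rw [triang_dom, Set.iUnion_sum] at h
  have hB := M.B.triang.dom_ae_eq
  have hD := M.D.triang.dom_ae_eq
  rw [SubMesh.triang_dom] at hB hD
  exact h.trans (hB.union hD).symm

/-- The intersection is null, since the open triangles are pairwise disjoint and exhaust both
regions up to null sets. Being open, it is empty. -/
theorem disjoint_dom : Disjoint M.B.dom M.D.dom := by
  have hB := M.B.triang.dom_ae_eq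
  have hD := M.D.triang.dom_ae_eq
  rw [SubMesh.triang_dom] at hB hD
  have h := hB.inter hD
  have hempty : (⋃ τ, interior (triangle (M.B.triang.vert τ))) ∩
      ⋃ τ, interior (triangle (M.D.triang.vert τ)) = ∅ := by
    rw [← Set.disjoint_iff_inter_eq_empty]
    refine Set.disjoint_iUnion_left.2 fun σ => Set.disjoint_iUnion_right.2 fun τ => ?_
    exact M.triang.pairwise_disjoint_interior (i := Sum.inl σ) (j := Sum.inr τ) (by simp)
  rw [hempty] at h
  have ho : IsOpen (M.B.dom ∩ M.D.dom) := isOpen_interior.inter isOpen_interior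
  rw [Set.disjoint_iff_inter_eq_empty]
  exact (ho.measure_eq_zero_iff volume).1 (by rw [measure_congr h, measure_empty])

theorem glue_of_mem_B (vB vD : E2 → E2) {x : E2} (hx : x ∈ M.B.dom) : M.glue vB vD x = vB x := by
  rw [glue, Set.indicator_of_mem hx,
    Set.indicator_of_notMem (Set.disjoint_left.1 M.disjoint_dom hx), add_zero]

theorem glue_of_mem_D (vB vD : E2 → E2) {x : E2} (hx : x ∈ M.D.dom) : M.glue vB vD x = vD x := by
  rw [glue, Set.indicator_of_mem hx,
    Set.indicator_of_notMem (Set.disjoint_right.1 M.disjoint_dom hx), zero_add]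

theorem measurableSet_domB : MeasurableSet M.B.dom := isOpen_interior.measurableSet

theorem measurableSet_domD : MeasurableSet M.D.dom := isOpen_interior.measurableSet

theorem integrableOn_dom {E : Type*} [NormedAddCommGroup E] {h : E2 → E} :
    IntegrableOn h M.dom ↔ IntegrableOn h M.B.dom ∧ IntegrableOn h M.D.dom := by
  rw [integrableOn_congr_set_ae dom_ae_eq, integrableOn_union]

theorem integral_dom {h : E2 → ℝ} (hB : IntegrableOn h M.B.dom) (hD : IntegrableOn h M.D.dom) :
    ∫ x in M.dom, h x = (∫ x in M.B.dom, h x) + ∫ x in M.D.dom, h x := by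
  rw [setIntegral_congr_set dom_ae_eq, setIntegral_union M.disjoint_dom measurableSet_domD hB hD]

theorem integrableOn_glue {vB vD : E2 → E2} (hB : IntegrableOn vB M.B.dom)
    (hD : IntegrableOn vD M.D.dom) : IntegrableOn (M.glue vB vD) M.dom :=
  integrableOn_dom.2 ⟨hB.congr_fun (fun _ hx => (glue_of_mem_B _ _ hx).symm) measurableSet_domB,
    hD.congr_fun (fun _ hx => (glue_of_mem_D _ _ hx).symm) measurableSet_domD⟩

theorem integral_fderiv_glue {U : Set E2} {φ : E2 → ℝ} (hφ : IsTest U φ) {vB vD : E2 → E2}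
    (hB : IntegrableOn vB M.B.dom) (hD : IntegrableOn vD M.D.dom) :
    ∫ x in M.dom, fderiv ℝ φ x (M.glue vB vD x) =
      (∫ x in M.B.dom, fderiv ℝ φ x (vB x)) + ∫ x in M.D.dom, fderiv ℝ φ x (vD x) := by
  obtain ⟨h1, h2⟩ := integrableOn_dom.1 (integrableOn_glue hB hD)
  rw [integral_dom (hφ.integrableOn_fderiv_apply h1) (hφ.integrableOn_fderiv_apply h2),
    setIntegral_congr_fun measurableSet_domB fun x hx => by rw [glue_of_mem_B vB vD hx],
    setIntegral_congr_fun measurableSet_domD fun x hx => by rw [glue_of_mem_D vB vD hx]]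

theorem isPiecewise_glue (vB : M.B.Vect) (vD : M.D.Vect) :
    M.triang.IsPiecewise (M.glue (funV vB) (funV vD))
      fun τ => evV ((Sum.elim vB vD : M.B.Tri ⊕ M.D.Tri → Fin 2 → Poly) τ) := by
  rintro (τ | τ) x hx
  · have hx' : x ∈ M.B.dom := SubMesh.triang_dom ▸ M.B.triang.interior_subset_dom τ hx
    rw [glue_of_mem_B _ _ hx']
    exact isPiecewise_funV vB τ x hx
  · have hx' : x ∈ M.D.dom := SubMesh.triang_dom ▸ M.D.triang.interior_subset_dom τ hx
    rw [glue_of_mem_D _ _ hx']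
    exact isPiecewise_funV vD τ x hx

/-- The piecewise divergence on the whole domain, if the divergence vanishes on `Ω_B`. -/
theorem isPiecewise_indicator {vB : M.B.Vect} (vD : M.D.Vect)
    (hB : ∀ τ : M.B.Tri, Set.EqOn (ev (divP (vB τ))) 0 (interior (triangle (vert τ)))) :
    M.triang.IsPiecewise (M.D.dom.indicator (funS fun τ => divP (vD τ)))
      fun τ => ev (divP ((Sum.elim vB vD : M.B.Tri ⊕ M.D.Tri → Fin 2 → Poly) τ)) := by
  rintro (τ | τ) x hx
  · have hx' : x ∈ M.B.dom := SubMesh.triang_dom ▸ M.B.triang.interior_subset_dom τ hx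
    rw [Set.indicator_of_notMem (Set.disjoint_left.1 M.disjoint_dom hx')]
    exact (hB τ hx).symm
  · have hx' : x ∈ M.D.dom := SubMesh.triang_dom ▸ M.D.triang.interior_subset_dom τ hx
    rw [Set.indicator_of_mem hx']
    exact isPiecewise_funS _ τ x hx

theorem integral_indicator_mul {g φ : E2 → ℝ} :
    ∫ x in M.dom, M.D.dom.indicator g x * φ x = ∫ x in M.D.dom, g x * φ x := by
  have h : ∀ x, M.D.dom.indicator g x * φ x = M.D.dom.indicator (fun x => g x * φ x) x := fun x => by
    by_cases hx : x ∈ M.D.dom <;> simp [hx]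
  have hsub : M.D.dom ⊆ M.dom := interior_mono Set.subset_union_right
  simp only [h]
  rw [setIntegral_indicator measurableSet_domD, Set.inter_eq_right.2 hsub]

end Mesh

end

end BrinkmanDarcy

/-! ### Strong mass conservation. -/

theorem mainTheorem2 (M : BrinkmanDarcy.Mesh) (k : ℕ) (hk : 1 ≤ k)
    (ε : ℝ) (hε : 0 < ε)
    (α : E2 → Matrix (Fin 2) (Fin 2) ℝ) (hα : ∀ x ∈ M.B.dom, (α x).PosDef)
    (hαint : ∀ i j, IntegrableOn (fun x => α x i j) M.B.dom)
    (K : E2 → Matrix (Fin 2) (Fin 2) ℝ) (hK : ∀ x ∈ M.D.dom, (K x).PosDef)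
    (hKint : ∀ i j, IntegrableOn (fun x => (K x)⁻¹ i j) M.D.dom)
    (fB fD : E2 → E2) (hfB : MemLp fB 2 (volume.restrict M.B.dom))
    (hfD : MemLp fD 2 (volume.restrict M.D.dom))
    (f : E2 → ℝ)
    (hf : ∃ q : M.D.Scal, M.MemQD k q ∧ f =ᵐ[volume.restrict M.D.dom] funS q)
    (g₁ g₂ : E2 → ℝ) (hg₁ : ∀ σ ∈ M.ΓB, MemL2Edge (va σ) (vb σ) g₁)
    (hg₂ : ∀ σ ∈ M.ΓD, MemL2Edge (va σ) (vb σ) g₂)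
    (hcompat : M.sumΓB (fun _ => g₁) + M.sumΓD (fun _ => g₂) = ∫ x in M.D.dom, f x)
    (L : M.B.Tens) (uB : M.B.Vect) (pB : M.B.Scal) (uD : M.D.Vect) (pD : M.D.Scal)
    (hsol : M.IsDiscreteSolution k ε α K fB fD f g₁ g₂ L uB pB uD pD) :
    (∀ e ∈ M.Γ, ∀ x ∈ segment ℝ (va e.1) (vb e.1),
      dotAt (uB e.1) (M.nD e) x = dotAt (uD e.2) (M.nD e) x) ∧
    MemHDiv M.dom (M.glue (funV uB) (funV uD)) ∧
    HasWeakDiv M.B.dom (funV uB) 0 ∧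
    HasWeakDiv M.D.dom (funV uD) f ∧
    (∀ σ ∈ M.ΓB, IsEdgeProj k (va σ) (vb σ) g₁ (dotAt (uB σ) (nPr σ))) ∧
    (∀ vB vD : E2 → E2, M.IsExactVelocity f vB vD →
      HasWeakDiv M.dom
        (fun x => M.glue vB vD x - M.glue (funV uB) (funV uD) x) 0) := by
  obtain ⟨q₀, hq₀, hfq⟩ := hf
  have hdiv := hsol.ae_eq_div hq₀ hfq
  have hΓ := hsol.sumΓ_eq hdiv hg₂ hcompat
  have hinterface := fun e (he : e ∈ M.Γ) x hx => hsol.interface hk hg₁ hΓ he (x := x) hx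
  have hB0 := hsol.divB_eq_zero hk hg₁ hΓ
  have hncB : M.B.triang.NormalContinuous uB := SubMesh.normalContinuous_of hsol.memuB.dual
    fun e he x hx => hsol.primal_jump_eq_zero hk hg₁ hΓ he hx
  have hncD := hsol.memuD.toMemHD.normalContinuous
  have hnc := Mesh.normalContinuous_of hncB hncD hinterface
  have hG := Mesh.isPiecewise_indicator uD hB0
  have hweak := (M.triang.hasWeakDiv_iff (Mesh.isPiecewise_glue uB uD) hG).2 hnc
  have hweakB : HasWeakDiv M.B.dom (funV uB) 0 := by
    rw [← SubMesh.triang_dom]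
    exact (M.B.triang.hasWeakDiv_iff (isPiecewise_funV uB)
      fun τ x hx => (hB0 τ hx).symm).2 hncB
  rw [Mesh.triang_dom] at hweak
  have hLp := (Mesh.isPiecewise_glue uB uD).memLp M.triang (fun τ => continuous_evV _) 2
  have hGLp := hG.memLp M.triang (fun τ => continuous_ev _) 2
  have hfin := M.triang.isFiniteMeasure_dom
  have hfinB := M.B.triang.isFiniteMeasure_dom
  have hfinD := M.D.triang.isFiniteMeasure_dom
  rw [Mesh.triang_dom] at hLp hGLp hfin
  rw [SubMesh.triang_dom] at hfinB hfinD
  refine ⟨hinterface, ⟨hLp, _, hGLp, hweak⟩, hweakB, hsol.hasWeakDivD hdiv,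
    fun σ hσ => hsol.isEdgeProj hk hg₁ hΓ hσ, fun vB vD hv φ hφ => ?_⟩
  have hvB : IntegrableOn vB M.B.dom := hv.memB.integrable one_le_two
  have hvD : IntegrableOn vD M.D.dom := hv.memD.integrable one_le_two
  have hfint : IntegrableOn f M.D.dom := by
    refine Integrable.congr ?_ hdiv.symm
    have := M.D.triang.integrableOn_dom (fun τ => continuous_ev _)
      (isPiecewise_funS fun τ => divP (uD τ))
    rwa [SubMesh.triang_dom] at this
  -- Cancellation of the normal traces gives ∫_Ω u · ∇φ = -∫_{Ω_D} f φ. The discrete field satisfies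
  -- the same identity (`hu`), so the difference is divergence free.
  have htrace := hv.interface φ hφ
  rw [hφ.normalTrace_eq hvD hfint,
    hφ.normalTrace_eq (g := 0) hvB integrableOn_zero] at htrace
  have hu := hweak φ hφ
  have hfφ : ∫ x in M.D.dom, funS (fun τ => divP (uD τ)) x * φ x = ∫ x in M.D.dom, f x * φ x := by
    refine integral_congr_ae ?_
    filter_upwards [hdiv] with x hx
    rw [hx]
  rw [Mesh.integral_indicator_mul, hfφ] at hu
  simp only [map_sub]
  rw [integral_sub (hφ.integrableOn_fderiv_apply (Mesh.integrableOn_glue hvB hvD))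
    (hφ.integrableOn_fderiv_apply (hLp.integrable one_le_two)),
    Mesh.integral_fderiv_glue hφ hvB hvD, hu]
  simp only [Pi.zero_apply, zero_mul, integral_zero, add_zero, neg_zero] at htrace ⊢
  linarith
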